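/- Let $p\geq 5$ be a prime. Let $B_k$ denote the Bernoulli numbers and put $\mathfrak{B}_k=B_k/k$ for $k\ge 2$. For $1\leq a\leq p-1$ let $q_a=\frac{a^{p-1}-1}{p}$ be the Fermat quotient in base $a$, let $w_p=\frac{(p-1)!+1}{p}$ be the Wilson quotient, and let $\mathcal{C}\mathfrak{B}(p-1)=\sum_{i=2}^{p-3}\mathfrak{B}_i\mathfrak{B}_{p-1-i}$. For a $p$-adic integer $x$ write $x=\sum_{i\geq 0}(x)_i\,p^i$ with $(x)_i\in\{0,\dots,p-1\}$ for its Hensel expansion. Then $\mathfrak{B}_{p+1}-\mathfrak{B}_2$, $\mathfrak{B}_{p-3}$, $w_p$, $\mathcal{C}\mathfrak{B}(p-1)$, $2p\,\mathfrak{B}_{2(p-1)}-p^2\mathfrak{B}_{p-1}^2$ and $\frac{pB_{3(p-1)}-3pB_{2(p-1)}+3pB_{p-1}-p+1}{2p^3}$ are $p$-adic integers, and $$-\frac12\sum_{a=1}^{p-1}\sum_{k=2}^{p-5}\frac{\mathfrak{B}_k}{a^k}\,q_a^2\equiv-(\mathfrak{B}_{p+1}-\mathfrak{B}_2)_1\,\mathfrak{B}_{p-3}+\frac{w_p}{2}\big(w_p^2+\mathcal{C}\mathfrak{B}(p-1)\big)-\frac{pB_{3(p-1)}-3pB_{2(p-1)}+3pB_{p-1}-p+1}{2p^3}\pmod{p\mathbb{Z}_p},$$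 where the residues of $w_p$ and $\mathcal{C}\mathfrak{B}(p-1)$ are given by $$w_p\equiv\frac{1+pB_{p-1}}{p}-1\pmod{p\mathbb{Z}_p},\qquad \mathcal{C}\mathfrak{B}(p-1)\equiv\big(2p\,\mathfrak{B}_{2(p-1)}-p^2\mathfrak{B}_{p-1}^2\big)_2\pmod{p\mathbb{Z}_p}.$$ (An empty sum is $0$.) -/

import Mathlib

/-- The divided Bernoulli number `B_k / k` (used only for `k ≥ 2`). -/
def dividedBernoulli (k : ℕ) : ℚ := bernoulli k / k

/-- The convolution `∑_{i=2}^{m-2} (B_i / i) (B_{m-i} / (m-i))` of divided Bernoulli numbers,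
of order `m`. -/
def dividedBernoulliConv (m : ℕ) : ℚ :=
  ∑ i ∈ Finset.Icc 2 (m - 2), dividedBernoulli i * dividedBernoulli (m - i)

/-- The Fermat quotient `q_a = (a^(p-1) - 1) / p` in base `a`. -/
def fermatQuotient (p a : ℕ) : ℚ := ((a : ℚ) ^ (p - 1) - 1) / p

/-- The Wilson quotient `w_p = ((p-1)! + 1) / p`. -/
def wilsonQuotient (p : ℕ) : ℚ := ((Nat.factorial (p - 1) : ℚ) + 1) / p

/-- The Agoh-Giuga quotient `(1 + p B_{p-1}) / p`. -/
def agohGiugaQuotient (p : ℕ) : ℚ := (1 + (p : ℚ) * bernoulli (p - 1)) / p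

/-- The rational number `x` is a `p`-adic integer. -/
def IsPadicIntegral (p : ℕ) [Fact p.Prime] (x : ℚ) : Prop := ‖(x : ℚ_[p])‖ ≤ 1

/-- Congruence modulo `p` of two rational numbers that are `p`-adic integers: the difference
belongs to `p ℤ_p`. -/
def PadicModEq (p : ℕ) [Fact p.Prime] (x y : ℚ) : Prop :=
  IsPadicIntegral p x ∧ IsPadicIntegral p y ∧ ∃ z : ℤ_[p], (x : ℚ_[p]) - (y : ℚ_[p]) = p * z

/-- The coefficient `(x)_i ∈ {0, …, p-1}` of `p^i` in the Hensel expansion `x = ∑ (x)_i p^i` of a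
`p`-adic integer. Here `x.appr n` is the representative of `x` modulo `p^n` in `[0, p^n)`. -/
noncomputable def PadicInt.henselResidue {p : ℕ} [Fact p.Prime] (x : ℤ_[p]) (i : ℕ) : ℕ :=
  x.appr (i + 1) / p ^ i

open Classical in
/-- The Hensel residue `(x)_i` of a rational number `x` that is a `p`-adic integer (and `0` for
other `x`). -/
noncomputable def henselResidue (p : ℕ) [Fact p.Prime] (x : ℚ) (i : ℕ) : ℕ :=
  if h : ‖(x : ℚ_[p])‖ ≤ 1 then PadicInt.henselResidue (⟨(x : ℚ_[p]), h⟩ : ℤ_[p]) i else 0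

namespace PadicBernoulli

open Finset

set_option linter.unusedSectionVars false

/-! Write `β_k = B_k/k`. Since `p q_a = a^(p-1) - 1`, the moment `∑ q_a^j a^k` is a `j`-th finite
difference, with step `p - 1`, of the power sums `S_m = ∑ a^m`, divided by `p^j`. Faulhaber's
expansion of `S_m` in powers of `p` turns these differences into Bernoulli numbers, and Kummer's
congruence (proved through Voronoi's) evaluates them modulo `p`.

The first moments are the Fourier coefficients of `a ↦ q_a` on `(ℤ/p)ˣ`, so inversion gives `q_a ≡
-w_p - a⁻¹/2 + ∑_{2 ≤ k ≤ p-3} β_k a⁻ᵏ` (`red_fermatQuotient_eq`). The inner sum of the theorem is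
therefore `q_a + w_p + a⁻¹/2 - β_{p-3} a²`. Multiplying by `q_a²` and summing over `a` leaves four
moments: `∑ q³`, `∑ q²`, `∑ q² a⁻¹` and `∑ q² a²`. Their isolated multiples of `β_{p-3}` cancel in
`red_doubleSum`.

The residue of `w_p` comes from computing `∑ q_a` both as a product and as a power sum; that of the
convolution from computing `∑ q_a²` both by Fourier inversion and as a power sum. -/

theorem not_dvd_two {p : ℕ} (h5 : 5 ≤ p) : ¬ p ∣ 2 := fun h => by
  have := Nat.le_of_dvd (by norm_num) h
  omega

theorem not_dvd_three {p : ℕ} (h5 : 5 ≤ p) : ¬ p ∣ 3 := fun h => by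
  have := Nat.le_of_dvd (by norm_num) h
  omega

theorem sum_Icc_eq_sum_range {p : ℕ} {A : Type*} [AddCommMonoid A] (h : 1 ≤ p) (f : ℕ → A)
    (h0 : f 0 = 0) : ∑ a ∈ Icc 1 (p - 1), f a = ∑ a ∈ range p, f a := by
  refine sum_subset (fun a ha => ?_) fun a ha ha' => ?_
  · rw [mem_Icc] at ha
    rw [mem_range]
    omega
  · rw [mem_range] at ha
    rw [mem_Icc] at ha'
    rw [show a = 0 by omega, h0]

/-- Exponential growth beats the linear denominators of the Faulhaber expansion; `p ≥ 5` transfers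
the bound to powers of `p`. -/
theorem add_lt_five_pow {c b k : ℕ} (h : b + c < 5 ^ b) (hk : b ≤ k) : k + c < 5 ^ k := by
  induction k, hk using Nat.le_induction with
  | base => exact h
  | succ n _ ih => rw [pow_succ]; omega

theorem lt_pow_of_five {p x k : ℕ} (h5 : 5 ≤ p) (h : x < 5 ^ k) : x < p ^ k :=
  h.trans_le (Nat.pow_le_pow_left h5 k)

theorem mul_lt_five_pow (k : ℕ) : (k + 3) * (k + 4) < 5 ^ (k + 2) := by
  induction k with
  | zero => norm_num
  | succ n ih => rw [show n + 1 + 2 = (n + 2) + 1 by ring, pow_succ]; nlinarith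

/-! ### The `p`-adic filtration of `ℚ` -/

variable {p : ℕ} [hp : Fact p.Prime]

/-- The rational numbers that lie in `p ^ n ℤ_[p]`. -/
def padicMultiples (p : ℕ) [Fact p.Prime] (n : ℕ) : AddSubgroup ℚ where
  carrier := {x | ∃ z : ℤ_[p], (x : ℚ_[p]) = (p : ℚ_[p]) ^ n * z}
  zero_mem' := ⟨0, by simp⟩
  add_mem' := by
    rintro x y ⟨z, hz⟩ ⟨w, hw⟩
    exact ⟨z + w, by push_cast; rw [hz, hw]; ring⟩
  neg_mem' := by
    rintro x ⟨z, hz⟩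
    exact ⟨-z, by push_cast; rw [hz]; ring⟩

local notation "M" => padicMultiples p

theorem mem_multiples {n : ℕ} {x : ℚ} :
    x ∈ M n ↔ ∃ z : ℤ_[p], (x : ℚ_[p]) = (p : ℚ_[p]) ^ n * z := Iff.rfl

theorem mem_zero_iff {x : ℚ} : x ∈ M 0 ↔ IsPadicIntegral p x := by
  constructor
  · rintro ⟨z, hz⟩
    rw [IsPadicIntegral, hz]
    simpa using z.norm_le_one
  · intro h
    exact ⟨⟨(x : ℚ_[p]), h⟩, by simp⟩

theorem cast_p_ne_zero : (p : ℚ) ≠ 0 := Nat.cast_ne_zero.2 hp.out.ne_zero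

theorem mul_mem {m n : ℕ} {x y : ℚ} (hx : x ∈ M m) (hy : y ∈ M n) : x * y ∈ M (m + n) := by
  obtain ⟨z, hz⟩ := hx
  obtain ⟨w, hw⟩ := hy
  exact ⟨z * w, by push_cast; rw [hz, hw]; ring⟩

theorem mul_mem_left {n : ℕ} {x y : ℚ} (hx : x ∈ M 0) (hy : y ∈ M n) : x * y ∈ M n := by
  simpa using mul_mem hx hy

theorem mul_mem_right {n : ℕ} {x y : ℚ} (hx : x ∈ M n) (hy : y ∈ M 0) : x * y ∈ M n := by
  simpa using mul_mem hx hy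

theorem natCast_mem (n : ℕ) : (n : ℚ) ∈ M 0 := ⟨n, by simp⟩

theorem intCast_mem (n : ℤ) : (n : ℚ) ∈ M 0 := ⟨n, by simp⟩

theorem one_mem : (1 : ℚ) ∈ M 0 := by simpa using natCast_mem (p := p) 1

theorem ofNat_mem (n : ℕ) [n.AtLeastTwo] : (OfNat.ofNat n : ℚ) ∈ M 0 := natCast_mem (p := p) n

theorem p_pow_mem (n : ℕ) : (p : ℚ) ^ n ∈ M n := ⟨1, by simp⟩

theorem p_mem : (p : ℚ) ∈ M 1 := by simpa using p_pow_mem (p := p) 1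

theorem multiples_anti {m n : ℕ} (h : m ≤ n) {x : ℚ} (hx : x ∈ M n) : x ∈ M m := by
  obtain ⟨z, hz⟩ := hx
  obtain ⟨k, rfl⟩ := Nat.exists_eq_add_of_le h
  exact ⟨p ^ k * z, by push_cast; rw [hz]; ring⟩

theorem pow_mem {x : ℚ} (hx : x ∈ M 0) (n : ℕ) : x ^ n ∈ M 0 := by
  induction n with
  | zero => simpa using one_mem
  | succ n ih => rw [pow_succ]; exact mul_mem_left ih hx

theorem p_pow_mul_mem_iff {k n : ℕ} {x : ℚ} : (p : ℚ) ^ k * x ∈ M (k + n) ↔ x ∈ M n := by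
  constructor
  · rintro ⟨z, hz⟩
    refine ⟨z, ?_⟩
    have h : (p : ℚ_[p]) ^ k ≠ 0 := pow_ne_zero _ (Nat.cast_ne_zero.2 hp.out.ne_zero)
    push_cast at hz
    rw [pow_add, mul_assoc] at hz
    exact mul_left_cancel₀ h hz
  · exact fun h => mul_mem (p_pow_mem k) h

theorem inv_mem {u : ℕ} (hu : ¬ p ∣ u) : (u : ℚ)⁻¹ ∈ M 0 := by
  rw [mem_zero_iff, IsPadicIntegral]
  have : ‖((u : ℕ) : ℚ_[p])‖ = 1 := by
    rw [Padic.norm_natCast_eq_one_iff]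
    exact (hp.out.coprime_iff_not_dvd).2 hu
  push_cast
  rw [norm_inv, this, inv_one]

theorem div_mem {n u : ℕ} (hu : ¬ p ∣ u) {x : ℚ} (hx : x ∈ M n) : x / u ∈ M n := by
  rw [div_eq_mul_inv]
  exact mul_mem_right hx (inv_mem hu)

/-- A positive integer below `p ^ (j + 1)` has `p`-adic valuation at most `j`. -/
theorem p_pow_div_mem {n j u : ℕ} (h0 : u ≠ 0) (hu : u < p ^ (j + 1)) :
    (p : ℚ) ^ (n + j) / u ∈ M n := by
  obtain ⟨v, u', hu', rfl⟩ := Nat.exists_eq_pow_mul_and_not_dvd h0 p hp.out.ne_one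
  have hv : v ≤ j := by
    by_contra! hv
    have h1 : p ^ (j + 1) ≤ p ^ v := Nat.pow_le_pow_right hp.out.pos hv
    have h2 : p ^ v ≤ p ^ v * u' := Nat.le_mul_of_pos_right _ (by
      rcases Nat.eq_zero_or_pos u' with rfl | h
      · simp at hu'
      · exact h)
    omega
  obtain ⟨k, rfl⟩ := Nat.exists_eq_add_of_le hv
  have hpv : (p : ℚ) ^ v ≠ 0 := pow_ne_zero _ cast_p_ne_zero
  have : (p : ℚ) ^ (n + (v + k)) / ((p ^ v * u' : ℕ) : ℚ) = (p : ℚ) ^ (n + k) / u' := by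
    push_cast
    rw [show n + (v + k) = v + (n + k) by ring, pow_add _ v, mul_div_mul_left _ _ hpv]
  rw [this]
  exact div_mem hu' (multiples_anti (by omega) (p_pow_mem (n + k)))

/-! ### Reduction modulo `p` -/

open Classical in
/-- Reduction modulo `p` of rational numbers that are `p`-adic integers. -/
noncomputable def red (p : ℕ) [Fact p.Prime] (x : ℚ) : ZMod p :=
  if h : ‖(x : ℚ_[p])‖ ≤ 1 then PadicInt.toZMod (⟨(x : ℚ_[p]), h⟩ : ℤ_[p]) else 0

theorem red_eq_of_coe {x : ℚ} {z : ℤ_[p]} (h : (x : ℚ_[p]) = z) :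
    red p x = PadicInt.toZMod z := by
  have hx : ‖(x : ℚ_[p])‖ ≤ 1 := by rw [h]; exact z.norm_le_one
  rw [red, dif_pos hx]
  congr 1
  exact Subtype.ext h

theorem mem_zero_coe {x : ℚ} (hx : x ∈ M 0) : ∃ z : ℤ_[p], (x : ℚ_[p]) = z := by
  obtain ⟨z, hz⟩ := hx
  exact ⟨z, by simpa using hz⟩

theorem red_add {x y : ℚ} (hx : x ∈ M 0) (hy : y ∈ M 0) : red p (x + y) = red p x + red p y := by
  obtain ⟨z, hz⟩ := mem_zero_coe hx
  obtain ⟨w, hw⟩ := mem_zero_coe hy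
  rw [red_eq_of_coe hz, red_eq_of_coe hw, ← map_add]
  exact red_eq_of_coe (by push_cast; rw [hz, hw])

theorem red_mul {x y : ℚ} (hx : x ∈ M 0) (hy : y ∈ M 0) : red p (x * y) = red p x * red p y := by
  obtain ⟨z, hz⟩ := mem_zero_coe hx
  obtain ⟨w, hw⟩ := mem_zero_coe hy
  rw [red_eq_of_coe hz, red_eq_of_coe hw, ← map_mul]
  exact red_eq_of_coe (by push_cast; rw [hz, hw])

@[simp] theorem red_natCast (n : ℕ) : red p (n : ℚ) = n := by
  rw [red_eq_of_coe (z := (n : ℤ_[p])) (by simp), map_natCast]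

@[simp] theorem red_zero : red p 0 = 0 := by simpa using red_natCast (p := p) 0

@[simp] theorem red_one : red p 1 = 1 := by simpa using red_natCast (p := p) 1

@[simp] theorem red_intCast (n : ℤ) : red p (n : ℚ) = n := by
  rw [red_eq_of_coe (z := (n : ℤ_[p])) (by simp), map_intCast]

theorem red_neg {x : ℚ} (hx : x ∈ M 0) : red p (-x) = -red p x := by
  have h := red_add hx (neg_mem hx)
  rw [add_neg_cancel, red_zero] at h
  exact (neg_eq_of_add_eq_zero_right h.symm).symm

theorem red_sub {x y : ℚ} (hx : x ∈ M 0) (hy : y ∈ M 0) : red p (x - y) = red p x - red p y := by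
  rw [sub_eq_add_neg, red_add hx (neg_mem hy), red_neg hy, sub_eq_add_neg]

theorem red_pow {x : ℚ} (hx : x ∈ M 0) (n : ℕ) : red p (x ^ n) = red p x ^ n := by
  induction n with
  | zero => simp
  | succ n ih => rw [pow_succ, pow_succ, red_mul (pow_mem hx n) hx, ih]

theorem red_sum {ι : Type*} (s : Finset ι) {f : ι → ℚ} (h : ∀ i ∈ s, f i ∈ M 0) :
    red p (∑ i ∈ s, f i) = ∑ i ∈ s, red p (f i) := by
  classical
  induction s using Finset.induction_on with
  | empty => simp
  | insert i s hi ih =>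
    rw [sum_insert hi, sum_insert hi, red_add (h i (mem_insert_self i s))
      (sum_mem fun j hj => h j (mem_insert_of_mem hj)),
      ih fun j hj => h j (mem_insert_of_mem hj)]

theorem red_eq_zero_iff {x : ℚ} (hx : x ∈ M 0) : red p x = 0 ↔ x ∈ M 1 := by
  obtain ⟨z, hz⟩ := mem_zero_coe hx
  rw [red_eq_of_coe hz, ← RingHom.mem_ker, PadicInt.ker_toZMod,
    PadicInt.maximalIdeal_eq_span_p, Ideal.mem_span_singleton]
  constructor
  · rintro ⟨w, rfl⟩
    exact ⟨w, by rw [hz]; push_cast; ring⟩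
  · rintro ⟨w, hw⟩
    refine ⟨w, ?_⟩
    apply Subtype.ext
    rw [hz] at hw
    push_cast
    simpa using hw

theorem red_eq_of_sub_mem {x y : ℚ} (hy : y ∈ M 0) (h : x - y ∈ M 1) : red p x = red p y := by
  have h0 : x - y ∈ M 0 := multiples_anti zero_le_one h
  have := (red_eq_zero_iff h0).2 h
  rw [show x = x - y + y by ring, red_add h0 hy, this, zero_add]

theorem sub_mem_of_red_eq {x y : ℚ} (hx : x ∈ M 0) (hy : y ∈ M 0) (h : red p x = red p y) :
    x - y ∈ M 1 := by
  rw [← red_eq_zero_iff (sub_mem hx hy), red_sub hx hy, h, sub_self]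

theorem padicModEq_iff {x y : ℚ} : PadicModEq p x y ↔ x ∈ M 0 ∧ y ∈ M 0 ∧ x - y ∈ M 1 := by
  rw [PadicModEq, mem_zero_iff, mem_zero_iff, mem_multiples]
  simp

theorem padicModEq_of_red_eq {x y : ℚ} (hx : x ∈ M 0) (hy : y ∈ M 0) (h : red p x = red p y) :
    PadicModEq p x y :=
  padicModEq_iff.2 ⟨hx, hy, sub_mem_of_red_eq hx hy h⟩

theorem red_inv {u : ℕ} (hu : ¬ p ∣ u) : red p (u : ℚ)⁻¹ = (u : ZMod p)⁻¹ := by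
  have h0 : (u : ZMod p) ≠ 0 := by rwa [Ne, ZMod.natCast_eq_zero_iff]
  have h1 : (u : ℚ) ≠ 0 := by
    rintro h
    rw [Nat.cast_eq_zero] at h
    simp [h] at hu
  have h := red_mul (natCast_mem (p := p) u) (inv_mem hu)
  rw [mul_inv_cancel₀ h1, red_one, red_natCast] at h
  exact eq_inv_of_mul_eq_one_right h.symm

/-! ### Denominators of Bernoulli numbers (von Staudt–Clausen) -/

theorem bernoulli_two_mul_mem {k : ℕ} (h : ¬ (p - 1) ∣ 2 * k) : bernoulli (2 * k) ∈ M 0 := by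
  obtain ⟨z, hz⟩ := Bernoulli.vonStaudt_clausen k
  rw [eq_sub_of_add_eq hz.symm]
  refine sub_mem (intCast_mem z) (sum_mem fun q hq => ?_)
  rw [mem_filter] at hq
  rw [one_div]
  refine inv_mem fun hpq => h ?_
  rw [(Nat.prime_dvd_prime_iff_eq hp.out hq.2.1).1 hpq]
  exact hq.2.2

theorem p_mul_bernoulli_two_mul_mem (k : ℕ) : (p : ℚ) * bernoulli (2 * k) ∈ M 0 := by
  obtain ⟨z, hz⟩ := Bernoulli.vonStaudt_clausen k
  rw [eq_sub_of_add_eq hz.symm, mul_sub, mul_sum]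
  refine sub_mem (mul_mem_left (natCast_mem p) (intCast_mem z)) (sum_mem fun q hq => ?_)
  rw [mem_filter] at hq
  by_cases hpq : p ∣ q
  · rw [← (Nat.prime_dvd_prime_iff_eq hp.out hq.2.1).1 hpq, mul_one_div_cancel cast_p_ne_zero]
    exact one_mem
  · rw [one_div]
    exact mul_mem_left (natCast_mem p) (inv_mem hpq)

theorem bernoulli_one_mem (h5 : 5 ≤ p) : bernoulli 1 ∈ M 0 := by
  rw [bernoulli_one, neg_div]
  exact neg_mem (by simpa using inv_mem (not_dvd_two h5))

theorem bernoulli_mem (h5 : 5 ≤ p) {m : ℕ} (h : ¬ (p - 1) ∣ m) : bernoulli m ∈ M 0 := by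
  rcases Nat.even_or_odd' m with ⟨k, rfl | rfl⟩
  · exact bernoulli_two_mul_mem h
  · rcases Nat.eq_zero_or_pos k with rfl | hk
    · exact bernoulli_one_mem h5
    · rw [bernoulli_eq_zero_of_odd (odd_two_mul_add_one k) (by omega)]
      exact zero_mem _

theorem p_mul_bernoulli_mem (h5 : 5 ≤ p) (m : ℕ) : (p : ℚ) * bernoulli m ∈ M 0 := by
  rcases Nat.even_or_odd' m with ⟨k, rfl | rfl⟩
  · exact p_mul_bernoulli_two_mul_mem k
  · rcases Nat.eq_zero_or_pos k with rfl | hk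
    · exact mul_mem_left (natCast_mem p) (bernoulli_one_mem h5)
    · rw [bernoulli_eq_zero_of_odd (odd_two_mul_add_one k) (by omega), mul_zero]
      exact zero_mem _

/-! ### Power sums and Faulhaber's expansion -/

/-- The sum of the `m`-th powers of `1, …, p - 1`. -/
def powerSum (p m : ℕ) : ℚ := ∑ a ∈ Icc 1 (p - 1), (a : ℚ) ^ m

/-- The `k`-th term of the expansion of `powerSum p m` in powers of `p`. -/
def faulhaberTerm (p m k : ℕ) : ℚ :=
  (m.choose k : ℚ) * bernoulli (m - k) * (p : ℚ) ^ (k + 1) / ((k + 1 : ℕ) : ℚ)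

/-- Faulhaber's formula, reflected so that `k` tracks the power of `p`; the coefficients match by
`(m+1) C(m,k) = (k+1) C(m+1,k+1)`. -/
theorem powerSum_eq {m : ℕ} (hm : m ≠ 0) :
    powerSum p m = ∑ k ∈ range (m + 1), faulhaberTerm p m k := by
  rw [powerSum, sum_Icc_eq_sum_range hp.out.one_le _ (by simp [hm]), sum_range_pow,
    ← sum_range_reflect]
  refine sum_congr rfl fun k hk => ?_
  rw [mem_range] at hk
  rw [faulhaberTerm]
  obtain ⟨j, rfl⟩ := Nat.exists_eq_add_of_le (Nat.le_of_lt_succ hk)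
  have h1 : k + j + 1 - 1 - k = j := by omega
  have h2 : k + j + 1 - j = k + 1 := by omega
  have h3 : k + j - k = j := by omega
  rw [h1, h2, h3]
  have h4 := Nat.add_one_mul_choose_eq (k + j) k
  have h5 : (k + j + 1).choose j = (k + j + 1).choose (k + 1) :=
    Nat.choose_symm_of_eq_add (by ring)
  rw [h5]
  have h6 : ((k + j : ℕ) + 1 : ℚ) * (k + j).choose k
      = ((k + j + 1).choose (k + 1) : ℚ) * ((k + 1 : ℕ) : ℚ) := by exact_mod_cast h4
  have h7 : ((k + j : ℕ) + 1 : ℚ) ≠ 0 := by positivity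
  have h8 : ((k + 1 : ℕ) : ℚ) ≠ 0 := by positivity
  rw [div_eq_div_iff h7 h8]
  linear_combination (-bernoulli j * (p : ℚ) ^ (k + 1)) * h6

theorem powerSum_eq_add_sum (n : ℕ) : powerSum p (n + 2) =
    ((p : ℚ) * bernoulli (n + 2) + ((n + 2 : ℕ) : ℚ) * bernoulli (n + 1) * (p : ℚ) ^ 2 / 2 +
      ((n + 2).choose 2 : ℚ) * bernoulli n * (p : ℚ) ^ 3 / 3) +
    ∑ k ∈ range n, faulhaberTerm p (n + 2) (k + 3) := by
  rw [powerSum_eq (by omega), sum_range_succ', sum_range_succ', sum_range_succ']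
  have e0 : faulhaberTerm p (n + 2) 0 = p * bernoulli (n + 2) := by
    simp [faulhaberTerm, mul_comm]
  have e1 : faulhaberTerm p (n + 2) (0 + 1) =
      ((n + 2 : ℕ) : ℚ) * bernoulli (n + 1) * (p : ℚ) ^ 2 / 2 := by
    norm_num [faulhaberTerm]
  have e2 : faulhaberTerm p (n + 2) (0 + 1 + 1) =
      ((n + 2).choose 2 : ℚ) * bernoulli n * (p : ℚ) ^ 3 / 3 := by
    norm_num [faulhaberTerm]
  rw [e0, e1, e2, add_assoc (∑ _ ∈ _, _), add_assoc (∑ _ ∈ _, _), add_comm (∑ _ ∈ _, _)]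
  congr 1
  ring

/-- One factor `p` makes the Bernoulli number integral, and the denominator `n + k + 1` costs at
most `k` more. -/
theorem faulhaberTerm_mem (h5 : 5 ≤ p) {m n k : ℕ} (hk : n + k + 1 < p ^ (k + 1)) :
    faulhaberTerm p m (n + k) ∈ M n := by
  have h := mul_mem_left (mul_mem_left (natCast_mem (p := p) (m.choose (n + k)))
    (p_mul_bernoulli_mem h5 (m - (n + k)))) (p_pow_div_mem (n := n) (Nat.succ_ne_zero _) hk)
  convert h using 1
  rw [faulhaberTerm]
  push_cast
  ring

theorem faulhaberTerm_mem_three (h5 : 5 ≤ p) (m k : ℕ) : faulhaberTerm p m (k + 3) ∈ M 3 := by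
  rw [add_comm]
  refine faulhaberTerm_mem h5 (lt_pow_of_five h5 ?_)
  have := add_lt_five_pow (c := 3) (b := 1) (by norm_num) (show 1 ≤ k + 1 by omega)
  omega

theorem faulhaberTerm_mem_four (h5 : 5 ≤ p) (m k : ℕ) : faulhaberTerm p m (k + 5) ∈ M 4 := by
  rw [show k + 5 = 4 + (k + 1) by ring]
  refine faulhaberTerm_mem h5 (lt_pow_of_five h5 ?_)
  have h : k + 2 + 4 < 5 ^ (k + 1 + 1) := add_lt_five_pow (b := 2) (by norm_num) (by omega)
  convert h using 1
  ring

theorem powerSum_sub_mem_three (h5 : 5 ≤ p) (n : ℕ) : powerSum p (n + 2) -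
    ((p : ℚ) * bernoulli (n + 2) + ((n + 2 : ℕ) : ℚ) * bernoulli (n + 1) * (p : ℚ) ^ 2 / 2 +
      ((n + 2).choose 2 : ℚ) * bernoulli n * (p : ℚ) ^ 3 / 3) ∈ M 3 := by
  rw [powerSum_eq_add_sum, add_sub_cancel_left]
  exact sum_mem fun k _ => faulhaberTerm_mem_three h5 _ k

theorem powerSum_sub_mem_four (h5 : 5 ≤ p) (n : ℕ) (h3 : faulhaberTerm p (n + 2) 3 ∈ M 4)
    (h4 : faulhaberTerm p (n + 2) 4 ∈ M 4) : powerSum p (n + 2) -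
    ((p : ℚ) * bernoulli (n + 2) + ((n + 2 : ℕ) : ℚ) * bernoulli (n + 1) * (p : ℚ) ^ 2 / 2 +
      ((n + 2).choose 2 : ℚ) * bernoulli n * (p : ℚ) ^ 3 / 3) ∈ M 4 := by
  rw [powerSum_eq_add_sum, add_sub_cancel_left]
  refine sum_mem fun k _ => ?_
  match k with
  | 0 => exact h3
  | 1 => exact h4
  | k + 2 => exact faulhaberTerm_mem_four h5 _ k

theorem powerSum_sub_mem_two (h5 : 5 ≤ p) (n : ℕ) (h : bernoulli (n + 1) ∈ M 0) :
    powerSum p (n + 2) - (p : ℚ) * bernoulli (n + 2) ∈ M 2 := by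
  have h1 := multiples_anti (show 2 ≤ 3 by norm_num) (powerSum_sub_mem_three h5 n)
  have h2 := mul_mem_left (natCast_mem (n + 2)) (mul_mem_left h
    (div_mem (not_dvd_two h5) (p_pow_mem 2)))
  have h3 := mul_mem_left (natCast_mem ((n + 2).choose 2)) (mul_mem_left
    (p_mul_bernoulli_mem h5 n) (div_mem (not_dvd_three h5) (p_pow_mem 2)))
  convert add_mem h1 (add_mem h2 h3) using 1
  push_cast
  ring

/-- The index `m = n + 2` may be divisible by `p`, but `C(m,k+1)/m = C(m-1,k)/(k+1)` removes it from
the denominators of all terms except the leading one. -/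
theorem powerSum_div_sub_mem (h5 : 5 ≤ p) {n : ℕ} (hn : Even n) :
    powerSum p (n + 2) / (((n + 2 : ℕ) : ℚ) * p) - dividedBernoulli (n + 2) ∈ M 1 := by
  have hp0 := cast_p_ne_zero (p := p)
  have hn0 : ((n + 2 : ℕ) : ℚ) ≠ 0 := by positivity
  have hterm : ∀ k, faulhaberTerm p (n + 2) (k + 1) / (((n + 2 : ℕ) : ℚ) * p) =
      ((n + 1).choose k : ℚ) * (p * bernoulli (n + 1 - k)) *
        ((p : ℚ) ^ k / (((k + 1) * (k + 2) : ℕ) : ℚ)) := by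
    intro k
    have h := Nat.add_one_mul_choose_eq (n + 1) k
    have h' : ((n + 2 : ℕ) : ℚ) * (n + 1).choose k
        = ((n + 2).choose (k + 1) : ℚ) * ((k + 1 : ℕ) : ℚ) := by exact_mod_cast h
    have h1 : ((k + 1 : ℕ) : ℚ) ≠ 0 := by positivity
    have h2 : ((k + 2 : ℕ) : ℚ) ≠ 0 := by positivity
    rw [faulhaberTerm, show n + 2 - (k + 1) = n + 1 - k by omega, Nat.cast_mul]
    field_simp
    linear_combination (-bernoulli (n + 1 - k) * (p : ℚ) ^ (k + 2)) * h'
  have h0 : faulhaberTerm p (n + 2) 0 / (((n + 2 : ℕ) : ℚ) * p) = dividedBernoulli (n + 2) := by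
    rw [faulhaberTerm, dividedBernoulli]
    simp only [Nat.choose_zero_right, tsub_zero, zero_add, Nat.cast_one, pow_one]
    field_simp
  rw [powerSum_eq (by omega), sum_div, sum_range_succ', h0, add_sub_cancel_right]
  refine sum_mem fun k _ => ?_
  rw [hterm]
  match k with
  | 0 =>
    -- This term is `p B_{n+1} / 2`, so `B_{n+1}` itself must be integral; as `n` is even, it is
    -- `B_1` or zero.
    have hb : bernoulli (n + 1) ∈ M 0 := by
      rcases Nat.eq_zero_or_pos n with rfl | hpos
      · exact bernoulli_one_mem h5
      · rw [bernoulli_eq_zero_of_odd hn.add_one (by omega)]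
        exact zero_mem _
    have h := div_mem (not_dvd_two h5) (mul_mem_right p_mem hb)
    convert h using 1
    simp
    ring
  | 1 =>
    have h := mul_mem_left (mul_mem_left (natCast_mem ((n + 1).choose 1))
      (p_mul_bernoulli_mem h5 n)) (div_mem (not_dvd_two h5) (div_mem (not_dvd_three h5) p_mem))
    convert h using 1
    rw [Nat.add_sub_cancel]
    push_cast
    ring
  | k + 2 =>
    refine mul_mem_left (mul_mem_left (natCast_mem _) (p_mul_bernoulli_mem h5 _)) ?_
    rw [show k + 2 = 1 + (k + 1) by ring]
    refine p_pow_div_mem (by positivity) (lt_pow_of_five h5 ?_)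
    have := mul_lt_five_pow k
    convert this using 1
    ring

/-- First-order Taylor expansion of `x^(n+1)/(n+1)`. Again `C(n+1,i+1)/(n+1) = C(n,i)/(i+1)` keeps
the congruence valid when `p` divides `n + 1`. -/
theorem add_pow_sub_pow_div_sub_mem (h5 : 5 ≤ p) (n r f : ℕ) :
    (((r : ℚ) + p * f) ^ (n + 1) - (r : ℚ) ^ (n + 1)) / (((n + 1 : ℕ) : ℚ) * p) - f * (r : ℚ) ^ n
      ∈ M 1 := by
  have hp0 := cast_p_ne_zero (p := p)
  have hterm : ∀ i, ((p : ℚ) * f) ^ (i + 1) * (r : ℚ) ^ (n + 1 - (i + 1)) *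
      ((n + 1).choose (i + 1) : ℚ) / (((n + 1 : ℕ) : ℚ) * p) =
      ((n.choose i * f ^ (i + 1) * r ^ (n - i) : ℕ) : ℚ) * ((p : ℚ) ^ i / ((i + 1 : ℕ) : ℚ)) := by
    intro i
    have h' : ((n + 1 : ℕ) : ℚ) * n.choose i
        = ((n + 1).choose (i + 1) : ℚ) * ((i + 1 : ℕ) : ℚ) := by
      exact_mod_cast Nat.add_one_mul_choose_eq n i
    have h1 : ((i + 1 : ℕ) : ℚ) ≠ 0 := by positivity
    have h2 : ((n + 1 : ℕ) : ℚ) ≠ 0 := by positivity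
    rw [show n + 1 - (i + 1) = n - i by omega, mul_pow]
    simp only [Nat.cast_mul, Nat.cast_pow]
    field_simp
    linear_combination (-(p : ℚ) ^ (i + 1) * f ^ (i + 1) * r ^ (n - i)) * h'
  rw [add_comm, add_pow, sum_range_succ']
  simp only [pow_zero, tsub_zero, one_mul, Nat.choose_zero_right, Nat.cast_one, mul_one,
    add_sub_cancel_right]
  rw [sum_div, sum_range_succ']
  simp only [hterm]
  simp only [Nat.choose_zero_right, zero_add, pow_one, tsub_zero, one_mul, pow_zero, Nat.cast_one,
    div_one, mul_one, Nat.cast_mul, Nat.cast_pow, add_sub_cancel_right]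
  refine sum_mem fun i _ => ?_
  refine mul_mem_left ?_ ?_
  · exact_mod_cast natCast_mem _
  · rw [add_comm i 1]
    refine p_pow_div_mem (by positivity) (lt_pow_of_five h5 ?_)
    have := add_lt_five_pow (c := 1) (b := 1) (by norm_num) (show 1 ≤ i + 1 by omega)
    omega

/-! ### Voronoi's and Kummer's congruences -/

/-- Multiplication by `g` permutes the nonzero residues. -/
theorem sum_mul_mod_eq {A : Type*} [AddCommMonoid A] {g : ℕ} (hg : ¬ p ∣ g) (F : ℕ → A) :
    ∑ j ∈ Icc 1 (p - 1), F (g * j % p) = ∑ j ∈ Icc 1 (p - 1), F j := by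
  have hp2 := hp.out.two_le
  have hinj : Set.InjOn (fun j => g * j % p) (Icc 1 (p - 1)) := by
    intro i hi j hj hij
    rw [coe_Icc, Set.mem_Icc] at hi hj
    have h : g * i ≡ g * j [MOD p] := hij
    have h' := Nat.ModEq.cancel_left_of_coprime ((hp.out.coprime_iff_not_dvd).2 hg) h
    exact h'.eq_of_lt_of_lt (by omega) (by omega)
  have himg : (Icc 1 (p - 1)).image (fun j => g * j % p) = Icc 1 (p - 1) := by
    refine eq_of_subset_of_card_le (fun x hx => ?_) (by rw [card_image_of_injOn hinj])
    obtain ⟨j, hj, rfl⟩ := mem_image.1 hx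
    rw [mem_Icc] at hj ⊢
    have h1 := Nat.mod_lt (g * j) hp.out.pos
    have h2 : g * j % p ≠ 0 := fun h => by
      rcases (hp.out.dvd_mul).1 (Nat.dvd_of_mod_eq_zero h) with h | h
      · exact hg h
      · exact Nat.not_dvd_of_pos_of_lt (by omega) (by omega) h
    omega
  conv_rhs => rw [← himg]
  rw [sum_image hinj]

/-- Voronoi's congruence for power sums. -/
theorem voronoi_powerSum (h5 : 5 ≤ p) (n : ℕ) {g : ℕ} (hg : ¬ p ∣ g) :
    ((g : ℚ) ^ (n + 1) - 1) * (powerSum p (n + 1) / (((n + 1 : ℕ) : ℚ) * p)) -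
      ∑ j ∈ Icc 1 (p - 1), ((g * j / p : ℕ) : ℚ) * ((g * j % p : ℕ) : ℚ) ^ n ∈ M 1 := by
  -- Each base `(gj mod p) + p ⌊gj/p⌋` is `gj`, while the remainders run through `1, …, p - 1`
  -- again.
  have h : ∑ j ∈ Icc 1 (p - 1), ((((g * j % p : ℕ) : ℚ) + p * ((g * j / p : ℕ) : ℚ)) ^ (n + 1) -
      ((g * j % p : ℕ) : ℚ) ^ (n + 1)) =
      ((g : ℚ) ^ (n + 1) - 1) * powerSum p (n + 1) := by
    rw [sum_sub_distrib, sum_mul_mod_eq hg (fun x => (x : ℚ) ^ (n + 1)), sub_mul, one_mul,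
      ← powerSum, powerSum, mul_sum]
    congr 1
    refine sum_congr rfl fun j _ => ?_
    rw [← mul_pow]
    congr 1
    exact_mod_cast Nat.mod_add_div (g * j) p
  rw [← mul_div_assoc, ← h, sum_div, ← sum_sub_distrib]
  exact sum_mem fun j _ => add_pow_sub_pow_div_sub_mem h5 n _ _

/-- The factor `g^(n+2) - 1` is a `p`-adic unit, so Voronoi's congruence yields integrality as well
as the residue. Both this factor and the right-hand side depend on `n` only modulo `p - 1`, which is
the source of Kummer's congruence. -/
theorem voronoi_red (h5 : 5 ≤ p) {n : ℕ} (hn : Even n) {g : ℕ} (hg : ¬ p ∣ g)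
    (hgn : (g : ZMod p) ^ (n + 2) ≠ 1) :
    dividedBernoulli (n + 2) ∈ M 0 ∧ ((g : ZMod p) ^ (n + 2) - 1) * red p (dividedBernoulli (n + 2))
      = ∑ j ∈ Icc 1 (p - 1), ((g * j / p : ℕ) : ZMod p) * ((g * j % p : ℕ) : ZMod p) ^ (n + 1) := by
  set E := ∑ j ∈ Icc 1 (p - 1), ((g * j / p : ℕ) : ℚ) * ((g * j % p : ℕ) : ℚ) ^ (n + 1) with hE
  have hterm : ∀ j ∈ Icc 1 (p - 1),
      ((g * j / p : ℕ) : ℚ) * ((g * j % p : ℕ) : ℚ) ^ (n + 1) ∈ M 0 := fun j _ =>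
    mul_mem_left (natCast_mem _) (pow_mem (natCast_mem _) _)
  have hE0 : E ∈ M 0 := sum_mem hterm
  have hv := voronoi_powerSum h5 (n + 1) hg
  rw [← hE, show n + 1 + 1 = n + 2 by ring] at hv
  have hS := powerSum_div_sub_mem h5 hn
  set T := powerSum p (n + 2) / (((n + 2 : ℕ) : ℚ) * p) with hT
  have hpos : 1 ≤ g ^ (n + 2) := Nat.one_le_pow _ _ (Nat.pos_of_ne_zero fun h => by simp [h] at hg)
  have hc : (g : ℚ) ^ (n + 2) - 1 = ((g ^ (n + 2) - 1 : ℕ) : ℚ) := by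
    push_cast [hpos]; rfl
  have hcz : (g : ZMod p) ^ (n + 2) - 1 = ((g ^ (n + 2) - 1 : ℕ) : ZMod p) := by
    push_cast [hpos]; rfl
  have hu : ¬ p ∣ g ^ (n + 2) - 1 := by
    rw [← ZMod.natCast_eq_zero_iff, ← hcz, sub_eq_zero]
    exact hgn
  have hu0 : ((g ^ (n + 2) - 1 : ℕ) : ℚ) ≠ 0 := fun h => by
    rw [Nat.cast_eq_zero] at h
    simp [h] at hu
  rw [hc] at hv
  have hT0 : T ∈ M 0 := by
    have h1 : ((g ^ (n + 2) - 1 : ℕ) : ℚ) * T ∈ M 0 := by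
      have := add_mem (multiples_anti zero_le_one hv) hE0
      rwa [sub_add_cancel] at this
    have h2 := div_mem hu h1
    rwa [mul_div_cancel_left₀ _ hu0] at h2
  have hb : dividedBernoulli (n + 2) ∈ M 0 := by
    have := sub_mem hT0 (multiples_anti zero_le_one hS)
    rwa [sub_sub_cancel] at this
  refine ⟨hb, ?_⟩
  rw [← red_eq_of_sub_mem hb hS, hcz, ← red_natCast, ← red_mul (natCast_mem _) hT0,
    red_eq_of_sub_mem hE0 hv, hE, red_sum _ hterm]
  refine sum_congr rfl fun j _ => ?_
  rw [red_mul (natCast_mem _) (pow_mem (natCast_mem _) _), red_pow (natCast_mem _), red_natCast,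
    red_natCast]

theorem exists_pow_ne_one {m : ℕ} (hm : ¬ (p - 1) ∣ m) :
    ∃ g : ℕ, ¬ p ∣ g ∧ (g : ZMod p) ^ m ≠ 1 := by
  have h := (FiniteField.forall_pow_eq_one_iff (ZMod p) m).not.2 (by rwa [ZMod.card])
  push Not at h
  obtain ⟨u, hu⟩ := h
  refine ⟨(u : ZMod p).val, ?_, ?_⟩
  · rw [← ZMod.natCast_eq_zero_iff, ZMod.natCast_zmod_val]
    exact u.ne_zero
  · rw [ZMod.natCast_zmod_val]
    exact fun h => hu (Units.ext (by simpa using h))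

theorem dividedBernoulli_mem (h5 : 5 ≤ p) {m : ℕ} (h1 : m ≠ 1) (hm : ¬ (p - 1) ∣ m) :
    dividedBernoulli m ∈ M 0 := by
  rcases Nat.even_or_odd m with he | ho
  · obtain ⟨n, rfl⟩ : ∃ n, m = n + 2 := ⟨m - 2, by
      have : m ≠ 0 := fun h => hm (h ▸ dvd_zero _)
      omega⟩
    obtain ⟨g, hg, hgn⟩ := exists_pow_ne_one hm
    exact (voronoi_red h5 ((Nat.even_add.1 he).2 even_two) hg hgn).1
  · have h0 : m ≠ 0 := fun h => hm (h ▸ dvd_zero _)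
    rw [dividedBernoulli, bernoulli_eq_zero_of_odd ho (by omega), zero_div]
    exact zero_mem _

/-- Kummer's congruence modulo `p`. -/
theorem red_dividedBernoulli_add (h5 : 5 ≤ p) {m : ℕ} (h1 : m ≠ 1) (hm : ¬ (p - 1) ∣ m) :
    red p (dividedBernoulli (m + (p - 1))) = red p (dividedBernoulli m) := by
  have hp1 : Even (p - 1) := hp.out.even_sub_one (by omega)
  have h0 : m ≠ 0 := fun h => hm (h ▸ dvd_zero _)
  rcases Nat.even_or_odd m with he | ho
  · obtain ⟨n, rfl⟩ : ∃ n, m = n + 2 := ⟨m - 2, by omega⟩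
    have hn : Even n := (Nat.even_add.1 he).2 even_two
    obtain ⟨g, hg, hgn⟩ := exists_pow_ne_one hm
    have hg0 : (g : ZMod p) ≠ 0 := by rwa [Ne, ZMod.natCast_eq_zero_iff]
    have hpow : (g : ZMod p) ^ (n + (p - 1) + 2) = (g : ZMod p) ^ (n + 2) := by
      rw [show n + (p - 1) + 2 = n + 2 + (p - 1) by ring, pow_add,
        ZMod.pow_card_sub_one_eq_one hg0, mul_one]
    have v1 := (voronoi_red h5 hn hg hgn).2
    have v2 := (voronoi_red h5 (hn.add hp1) hg (by rwa [hpow])).2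
    rw [hpow] at v2
    have hE : ∀ x : ZMod p, x ^ (n + (p - 1) + 1) = x ^ (n + 1) := fun x => by
      rw [show n + (p - 1) + 1 = n + p by omega, pow_add, ZMod.pow_card, pow_succ]
    simp only [hE] at v2
    rw [show n + 2 + (p - 1) = n + (p - 1) + 2 by ring]
    exact mul_left_cancel₀ (sub_ne_zero.2 hgn) (v2.trans v1.symm)
  · rw [dividedBernoulli, dividedBernoulli, bernoulli_eq_zero_of_odd ho (by omega),
      bernoulli_eq_zero_of_odd (ho.add_even hp1) (by omega), zero_div, zero_div]

theorem red_bernoulli (h5 : 5 ≤ p) {m : ℕ} (h1 : m ≠ 1) (hm : ¬ (p - 1) ∣ m) :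
    red p (bernoulli m) = m * red p (dividedBernoulli m) := by
  have h0 : (m : ℚ) ≠ 0 := Nat.cast_ne_zero.2 fun h => hm (h ▸ dvd_zero _)
  rw [← red_natCast, ← red_mul (natCast_mem m) (dividedBernoulli_mem h5 h1 hm), dividedBernoulli,
    mul_div_cancel₀ _ h0]

/-! ### Bernoulli numbers along a residue class modulo `p - 1` -/

theorem div_p_pow_mem {k n : ℕ} {x : ℚ} (hx : x ∈ M (k + n)) : x / (p : ℚ) ^ k ∈ M n := by
  rw [← p_pow_mul_mem_iff (k := k), mul_div_cancel₀ _ (pow_ne_zero _ cast_p_ne_zero)]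
  exact hx

theorem not_dvd_add_mul {r : ℕ} (h0 : 0 < r) (h1 : r < p - 1) (i : ℕ) :
    ¬ (p - 1) ∣ r + i * (p - 1) := by
  rw [Nat.dvd_add_left (dvd_mul_left _ _)]
  exact Nat.not_dvd_of_pos_of_lt h0 h1

theorem natCast_sub_one : ((p - 1 : ℕ) : ZMod p) = -1 := by
  rw [Nat.cast_sub hp.out.one_le]
  simp

theorem red_dividedBernoulli_add_mul (h5 : 5 ≤ p) {r : ℕ} (h2 : 2 ≤ r) (h1 : r < p - 1) (i : ℕ) :
    red p (dividedBernoulli (r + i * (p - 1))) = red p (dividedBernoulli r) := by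
  induction i with
  | zero => simp
  | succ i ih =>
    rw [add_mul, one_mul, ← add_assoc,
      red_dividedBernoulli_add h5 (by omega) (not_dvd_add_mul (by omega) h1 i), ih]

/-- By Kummer the divided number is constant along the class, and the index is `r - i` modulo `p`.
Hence `B` is affine in `i`, ready for finite differences. -/
theorem red_bernoulli_add_mul (h5 : 5 ≤ p) {r : ℕ} (h2 : 2 ≤ r) (h1 : r < p - 1) (i : ℕ) :
    red p (bernoulli (r + i * (p - 1))) = ((r : ZMod p) - i) * red p (dividedBernoulli r) := by
  rw [red_bernoulli h5 (by omega) (not_dvd_add_mul (by omega) h1 i),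
    red_dividedBernoulli_add_mul h5 h2 h1]
  push_cast
  rw [natCast_sub_one]
  ring

theorem powerSum_congr_three (h5 : 5 ≤ p) {m : ℕ} (hm : 2 ≤ m) : powerSum p m -
    ((p : ℚ) * bernoulli m + (m : ℚ) * bernoulli (m - 1) * (p : ℚ) ^ 2 / 2 +
      (m.choose 2 : ℚ) * bernoulli (m - 2) * (p : ℚ) ^ 3 / 3) ∈ M 3 := by
  obtain ⟨n, rfl⟩ := Nat.exists_eq_add_of_le' hm
  exact powerSum_sub_mem_three h5 n

theorem powerSum_congr_two (h5 : 5 ≤ p) {m : ℕ} (hm : 2 ≤ m) (h : bernoulli (m - 1) ∈ M 0) :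
    powerSum p m - (p : ℚ) * bernoulli m ∈ M 2 := by
  obtain ⟨n, rfl⟩ := Nat.exists_eq_add_of_le' hm
  exact powerSum_sub_mem_two h5 n h

/-! ### Moments of Fermat quotients -/

theorem not_dvd_of_mem_Icc {a : ℕ} (ha : a ∈ Icc 1 (p - 1)) : ¬ p ∣ a := by
  rw [mem_Icc] at ha
  exact Nat.not_dvd_of_pos_of_lt (by omega) (by have := hp.out.one_le; omega)

theorem cast_ne_zero_of_mem_Icc {a : ℕ} (ha : a ∈ Icc 1 (p - 1)) : (a : ZMod p) ≠ 0 := by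
  rw [Ne, ZMod.natCast_eq_zero_iff]
  exact not_dvd_of_mem_Icc ha

theorem fermatQuotient_mem {a : ℕ} (ha : ¬ p ∣ a) : fermatQuotient p a ∈ M 0 := by
  have ha' : (a : ZMod p) ≠ 0 := by rwa [Ne, ZMod.natCast_eq_zero_iff]
  have h : ((a : ℚ) ^ (p - 1) - 1) ∈ M (1 + 0) := by
    rw [← red_eq_zero_iff (sub_mem (pow_mem (natCast_mem a) _) one_mem),
      red_sub (pow_mem (natCast_mem a) _) one_mem, red_pow (natCast_mem a), red_natCast, red_one,
      ZMod.pow_card_sub_one_eq_one ha', sub_self]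
  simpa [fermatQuotient] using div_p_pow_mem h

theorem sum_fermatQuotient_mul_pow (k : ℕ) :
    ∑ a ∈ Icc 1 (p - 1), fermatQuotient p a * (a : ℚ) ^ k =
      (powerSum p (k + 1 * (p - 1)) - powerSum p k) / p := by
  rw [powerSum, powerSum, ← sum_sub_distrib, sum_div]
  refine sum_congr rfl fun a _ => ?_
  rw [fermatQuotient, pow_add, pow_mul, pow_one]
  ring

theorem sum_fermatQuotient_sq_mul_pow (k : ℕ) :
    ∑ a ∈ Icc 1 (p - 1), fermatQuotient p a ^ 2 * (a : ℚ) ^ k =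
      (powerSum p (k + 2 * (p - 1)) - 2 * powerSum p (k + 1 * (p - 1)) + powerSum p k) /
        (p : ℚ) ^ 2 := by
  simp only [powerSum]
  rw [mul_sum, ← sum_sub_distrib, ← sum_add_distrib, sum_div]
  refine sum_congr rfl fun a _ => ?_
  rw [fermatQuotient, pow_add, pow_add, mul_comm 2, mul_comm 1, pow_mul, pow_mul]
  ring

theorem sum_fermatQuotient_cube :
    ∑ a ∈ Icc 1 (p - 1), fermatQuotient p a ^ 3 =
      (powerSum p (3 * (p - 1)) - 3 * powerSum p (2 * (p - 1)) + 3 * powerSum p (1 * (p - 1)) -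
        ((p : ℚ) - 1)) / (p : ℚ) ^ 3 := by
  have h0 : (p : ℚ) - 1 = ∑ a ∈ Icc 1 (p - 1), (1 : ℚ) := by
    simp [hp.out.one_le]
  rw [h0]
  simp only [powerSum]
  rw [mul_sum, mul_sum, ← sum_sub_distrib, ← sum_add_distrib, ← sum_sub_distrib, sum_div]
  refine sum_congr rfl fun a _ => ?_
  rw [fermatQuotient, mul_comm 3, mul_comm 2, mul_comm 1, pow_mul, pow_mul, pow_mul]
  ring

theorem red_sum_fermatQuotient (j k : ℕ) :
    red p (∑ a ∈ Icc 1 (p - 1), fermatQuotient p a ^ j * (a : ℚ) ^ k) =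
      ∑ a ∈ Icc 1 (p - 1), red p (fermatQuotient p a) ^ j * (a : ZMod p) ^ k := by
  have hq : ∀ a ∈ Icc 1 (p - 1), fermatQuotient p a ∈ M 0 := fun a ha =>
    fermatQuotient_mem (not_dvd_of_mem_Icc ha)
  rw [red_sum _ fun a ha => mul_mem_left (pow_mem (hq a ha) j) (pow_mem (natCast_mem a) k)]
  refine sum_congr rfl fun a ha => ?_
  rw [red_mul (pow_mem (hq a ha) j) (pow_mem (natCast_mem a) k), red_pow (hq a ha),
    red_pow (natCast_mem a), red_natCast]

theorem sum_fermatQuotient_mem (j k : ℕ) :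
    ∑ a ∈ Icc 1 (p - 1), fermatQuotient p a ^ j * (a : ℚ) ^ k ∈ M 0 :=
  sum_mem fun a ha => mul_mem_left (pow_mem (fermatQuotient_mem (not_dvd_of_mem_Icc ha)) j)
    (pow_mem (natCast_mem a) k)

/-- The moment is congruent to `B_{k+p-1} - B_k ≡ (k-1) β_k - k β_k`. -/
theorem sum_red_fermatQuotient_mul_pow (h5 : 5 ≤ p) {k : ℕ} (h2 : 2 ≤ k) (hk : k < p - 1) :
    ∑ a ∈ Icc 1 (p - 1), red p (fermatQuotient p a) * (a : ZMod p) ^ k =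
      -red p (dividedBernoulli k) := by
  have h := red_sum_fermatQuotient (p := p) 1 k
  simp only [pow_one] at h
  rw [← h, sum_fermatQuotient_mul_pow]
  have hb : ∀ i, bernoulli (k + i * (p - 1)) ∈ M 0 := fun i =>
    bernoulli_mem h5 (not_dvd_add_mul (by omega) hk i)
  have hb' : ∀ i, bernoulli (k + i * (p - 1) - 1) ∈ M 0 := fun i => by
    rw [show k + i * (p - 1) - 1 = k - 1 + i * (p - 1) by omega]
    exact bernoulli_mem h5 (not_dvd_add_mul (by omega) (by omega) i)
  have s1 := powerSum_congr_two h5 (show 2 ≤ k + 1 * (p - 1) by omega) (hb' 1)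
  have s0 := powerSum_congr_two h5 (show 2 ≤ k + 0 * (p - 1) by omega) (hb' 0)
  have s := div_p_pow_mem (k := 1) (n := 1) (sub_mem s1 s0)
  have hp0 := cast_p_ne_zero (p := p)
  rw [red_eq_of_sub_mem (y := bernoulli (k + 1 * (p - 1)) - bernoulli (k + 0 * (p - 1))),
    red_sub (hb 1) (hb 0), red_bernoulli_add_mul h5 h2 hk, red_bernoulli_add_mul h5 h2 hk]
  · push_cast
    ring
  · exact sub_mem (hb 1) (hb 0)
  · convert s using 1
    rw [zero_mul, add_zero]
    field_simp
    ring

theorem odd_prime (h5 : 5 ≤ p) : Odd p := hp.out.odd_of_ne_two (by omega)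

/-- The exceptional index `k = 1`: `S_p` is divisible by `p²`, so only `S_1 = p(p-1)/2` contributes.
-/
theorem sum_red_fermatQuotient_mul_self (h5 : 5 ≤ p) :
    ∑ a ∈ Icc 1 (p - 1), red p (fermatQuotient p a) * (a : ZMod p) = 2⁻¹ := by
  have h := red_sum_fermatQuotient (p := p) 1 1
  have e := sum_fermatQuotient_mul_pow (p := p) 1
  simp only [pow_one] at h e
  rw [← h, e, show 1 + 1 * (p - 1) = p by omega]
  have hodd := odd_prime h5
  have s := powerSum_congr_three h5 (show 2 ≤ p by omega)
  have s1 : powerSum p 1 = (p : ℚ) ^ 2 / 2 - p / 2 := by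
    rw [powerSum_eq one_ne_zero, sum_range_succ, sum_range_one]
    norm_num [faulhaberTerm]
    ring
  rw [bernoulli_eq_zero_of_odd hodd (by omega), bernoulli_eq_zero_of_odd
    (show Odd (p - 2) from Nat.Odd.sub_even (by omega) hodd even_two) (by omega)] at s
  have t := mul_mem_right (p_pow_mem (p := p) 2) (div_mem (not_dvd_two h5)
    (p_mul_bernoulli_mem h5 (p - 1)))
  have t2 := div_mem (not_dvd_two h5) (p_pow_mem (p := p) 2)
  have u := div_p_pow_mem (k := 1) (n := 1)
    (sub_mem (add_mem (multiples_anti (show 2 ≤ 3 by norm_num) s) t) t2)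
  have hi : (((2 : ℕ) : ℚ))⁻¹ ∈ M 0 := inv_mem (not_dvd_two h5)
  have hp0 := cast_p_ne_zero (p := p)
  rw [red_eq_of_sub_mem (y := ((2 : ℕ) : ℚ)⁻¹) hi, red_inv (not_dvd_two h5)]
  · norm_num
  · convert u using 1
    rw [s1]
    push_cast
    field_simp
    ring

theorem prod_one_add_p_mul_sub_mem {ι : Type*} (s : Finset ι) {x : ι → ℚ}
    (hx : ∀ i ∈ s, x i ∈ M 0) : ∏ i ∈ s, (1 + p * x i) - (1 + p * ∑ i ∈ s, x i) ∈ M 2 := by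
  classical
  induction s using Finset.induction_on with
  | empty => simp
  | insert i s hi ih =>
    have hs := fun j hj => hx j (mem_insert_of_mem hj)
    have hi0 := hx i (mem_insert_self i s)
    have h1 : 1 + (p : ℚ) * x i ∈ M 0 := add_mem one_mem (mul_mem_left (natCast_mem p) hi0)
    have h2 := mul_mem (m := 1) (n := 1) (mul_mem_right p_mem hi0) (mul_mem_right p_mem (sum_mem hs))
    rw [prod_insert hi, sum_insert hi]
    convert add_mem (mul_mem_left h1 (ih hs)) h2 using 1
    ring

theorem wilsonQuotient_mem : wilsonQuotient p ∈ M 0 := by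
  have h : ((Nat.factorial (p - 1) : ℚ) + 1) ∈ M (1 + 0) := by
    rw [← red_eq_zero_iff (add_mem (natCast_mem _) one_mem),
      red_add (natCast_mem _) one_mem, red_natCast, red_one, ZMod.wilsons_lemma, neg_add_cancel]
  simpa [wilsonQuotient] using div_p_pow_mem h

/-- Lerch's formula: `∏ (1 + p q_a) = ((p-1)!)^(p-1) = (1 - p w_p)^(p-1)`, the sign disappearing
because `p - 1` is even. Compare the terms linear in `p`. -/
theorem sum_fermatQuotient_sub_wilsonQuotient_mem (h5 : 5 ≤ p) :
    ∑ a ∈ Icc 1 (p - 1), fermatQuotient p a - wilsonQuotient p ∈ M 1 := by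
  have hp0 := cast_p_ne_zero (p := p)
  have hw := wilsonQuotient_mem (p := p)
  have h1 := prod_one_add_p_mul_sub_mem (Icc 1 (p - 1)) (x := fermatQuotient p)
    fun a ha => fermatQuotient_mem (not_dvd_of_mem_Icc ha)
  have h2 := prod_one_add_p_mul_sub_mem (Icc 1 (p - 1)) (x := fun _ => -wilsonQuotient p)
    fun _ _ => neg_mem hw
  have e : ∏ a ∈ Icc 1 (p - 1), (1 + p * fermatQuotient p a) =
      ∏ _a ∈ Icc 1 (p - 1), (1 + p * -wilsonQuotient p) := by
    have e1 : ∀ a, 1 + p * fermatQuotient p a = (a : ℚ) ^ (p - 1) := fun a => by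
      rw [fermatQuotient, mul_div_cancel₀ _ hp0]
      ring
    have e2 : 1 + p * -wilsonQuotient p = -(Nat.factorial (p - 1) : ℚ) := by
      rw [wilsonQuotient, mul_neg, mul_div_cancel₀ _ hp0]
      ring
    have e3 : ∏ a ∈ Icc 1 (p - 1), (a : ℚ) = Nat.factorial (p - 1) := by
      rw [← prod_Ico_id_eq_factorial, Nat.cast_prod]
      rfl
    rw [e2, prod_const, Nat.card_Icc, Nat.add_sub_cancel,
      (hp.out.even_sub_one (by omega)).neg_pow, ← e3, ← prod_pow]
    exact prod_congr rfl fun a _ => e1 a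
  have h3 := div_p_pow_mem (k := 1) (n := 1) (sub_mem h2 h1)
  have h4 := mul_mem_right p_mem hw
  convert sub_mem h3 h4 using 1
  rw [e, sum_const, Nat.card_Icc, Nat.add_sub_cancel, nsmul_eq_mul, Nat.cast_sub hp.out.one_le]
  field_simp
  push_cast
  ring

theorem powerSum_one_mul_sub_mem (h5 : 5 ≤ p) :
    powerSum p (1 * (p - 1)) - p * bernoulli (p - 1) ∈ M 2 := by
  have h := powerSum_congr_two h5 (show 2 ≤ p - 1 by omega)
    (bernoulli_mem h5 (Nat.not_dvd_of_pos_of_lt (by omega) (by omega)))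
  rwa [one_mul]

theorem powerSum_zero : powerSum p 0 = p - 1 := by
  simp [powerSum, hp.out.one_le]

theorem sum_fermatQuotient_sub_agohGiugaQuotient_mem (h5 : 5 ≤ p) :
    ∑ a ∈ Icc 1 (p - 1), fermatQuotient p a - (agohGiugaQuotient p - 1) ∈ M 1 := by
  have hp0 := cast_p_ne_zero (p := p)
  have e := sum_fermatQuotient_mul_pow (p := p) 0
  simp only [pow_zero, mul_one, zero_add] at e
  convert div_p_pow_mem (k := 1) (n := 1) (powerSum_one_mul_sub_mem h5) using 1
  rw [e, powerSum_zero, agohGiugaQuotient]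
  field_simp
  ring

/-- Both sides are congruent to `∑ q_a`, by Lerch's formula and by Faulhaber's expansion of
`S_{p-1}`. -/
theorem wilsonQuotient_modEq (h5 : 5 ≤ p) :
    PadicModEq p (wilsonQuotient p) (agohGiugaQuotient p - 1) := by
  have h := sub_mem (sum_fermatQuotient_sub_agohGiugaQuotient_mem h5)
    (sum_fermatQuotient_sub_wilsonQuotient_mem h5)
  rw [sub_sub_sub_cancel_left] at h
  have hw := wilsonQuotient_mem (p := p)
  refine padicModEq_iff.2 ⟨hw, ?_, h⟩
  have := sub_mem hw (multiples_anti zero_le_one h)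
  rwa [sub_sub_cancel] at this

theorem sum_red_fermatQuotient (h5 : 5 ≤ p) :
    ∑ a ∈ Icc 1 (p - 1), red p (fermatQuotient p a) = red p (wilsonQuotient p) := by
  have h := red_sum_fermatQuotient (p := p) 1 0
  simp only [pow_one, pow_zero, mul_one] at h
  rw [← h, red_eq_of_sub_mem wilsonQuotient_mem (sum_fermatQuotient_sub_wilsonQuotient_mem h5)]

theorem two_ne_zero_zmod (h5 : 5 ≤ p) : (2 : ZMod p) ≠ 0 := by
  have := not_dvd_two h5
  rw [← ZMod.natCast_eq_zero_iff] at this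
  exact_mod_cast this

theorem three_ne_zero_zmod (h5 : 5 ≤ p) : (3 : ZMod p) ≠ 0 := by
  have := not_dvd_three h5
  rw [← ZMod.natCast_eq_zero_iff] at this
  exact_mod_cast this

/-- The exponents `m = p - 2 + i(p-1)` are odd, so the leading term of `S_m` is `p² m B_{m-1} / 2`,
where `m B_{m-1} ≡ (i+2)(i+3) β_{p-3}` has second difference `2 β_{p-3}`. -/
theorem sum_red_fermatQuotient_sq_mul_pow_sub_two (h5 : 5 ≤ p) :
    ∑ a ∈ Icc 1 (p - 1), red p (fermatQuotient p a) ^ 2 * (a : ZMod p) ^ (p - 2) =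
      red p (dividedBernoulli (p - 3)) := by
  have hp0 := cast_p_ne_zero (p := p)
  have hodd : Odd (p - 2) := Nat.Odd.sub_even (by omega) (odd_prime h5) even_two
  have hev : Even (p - 1) := hp.out.even_sub_one (by omega)
  have hB : ∀ i, bernoulli (p - 3 + i * (p - 1)) ∈ M 0 := fun i =>
    bernoulli_mem h5 (not_dvd_add_mul (by omega) (by omega) i)
  have key : ∀ i, powerSum p (p - 2 + i * (p - 1)) -
      ((p - 2 + i * (p - 1) : ℕ) : ℚ) * bernoulli (p - 3 + i * (p - 1)) * (p : ℚ) ^ 2 / (2 : ℕ)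
        ∈ M 3 := by
    intro i
    have h := powerSum_congr_three h5 (show 2 ≤ p - 2 + i * (p - 1) by omega)
    have hb : bernoulli (p - 2 + i * (p - 1) - 2) ∈ M 0 := by
      rw [show p - 2 + i * (p - 1) - 2 = p - 4 + i * (p - 1) by omega]
      exact bernoulli_mem h5 (not_dvd_add_mul (by omega) (by omega) i)
    rw [bernoulli_eq_zero_of_odd (hodd.add_even (hev.mul_left i)) (by omega),
      show p - 2 + i * (p - 1) - 1 = p - 3 + i * (p - 1) by omega] at h
    have t := mul_mem_left (mul_mem_left (natCast_mem ((p - 2 + i * (p - 1)).choose 2)) hb)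
      (div_mem (not_dvd_three h5) (p_pow_mem (p := p) 3))
    convert add_mem h t using 1
    push_cast
    ring
  have hT : ∀ i, ((p - 2 + i * (p - 1) : ℕ) : ℚ) * bernoulli (p - 3 + i * (p - 1)) ∈ M 0 :=
    fun i => mul_mem_left (natCast_mem _) (hB i)
  have hTr : ∀ i : ℕ, red p (((p - 2 + i * (p - 1) : ℕ) : ℚ) * bernoulli (p - 3 + i * (p - 1))) =
      (-2 - i) * ((-3 - i) * red p (dividedBernoulli (p - 3))) := by
    intro i
    rw [red_mul (natCast_mem _) (hB i), red_natCast,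
      red_bernoulli_add_mul h5 (by omega) (by omega)]
    push_cast
    rw [natCast_sub_one, Nat.cast_sub (by omega), Nat.cast_sub (by omega)]
    push_cast
    rw [CharP.cast_eq_zero]
    ring
  have s := div_p_pow_mem (k := 2) (n := 1)
    (add_mem (sub_mem (key 2) (mul_mem_left (ofNat_mem 2) (key 1))) (key 0))
  have hc : ((p - 2 + 2 * (p - 1) : ℕ) : ℚ) * bernoulli (p - 3 + 2 * (p - 1)) -
      ((2 : ℕ) : ℚ) * (((p - 2 + 1 * (p - 1) : ℕ) : ℚ) * bernoulli (p - 3 + 1 * (p - 1))) +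
      ((p - 2 + 0 * (p - 1) : ℕ) : ℚ) * bernoulli (p - 3 + 0 * (p - 1)) ∈ M 0 :=
    add_mem (sub_mem (hT 2) (mul_mem_left (natCast_mem 2) (hT 1))) (hT 0)
  rw [← red_sum_fermatQuotient, sum_fermatQuotient_sq_mul_pow]
  rw [red_eq_of_sub_mem (mul_mem_left (inv_mem (not_dvd_two h5)) hc),
    red_mul (inv_mem (not_dvd_two h5)) hc, red_inv (not_dvd_two h5),
    red_add (sub_mem (hT 2) (mul_mem_left (natCast_mem 2) (hT 1))) (hT 0),
    red_sub (hT 2) (mul_mem_left (natCast_mem 2) (hT 1)), red_mul (natCast_mem 2) (hT 1),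
    hTr, hTr, hTr, red_natCast]
  · have h2 := two_ne_zero_zmod h5
    push_cast
    field_simp
    ring
  · convert s using 1
    rw [zero_mul, add_zero, add_zero]
    field_simp
    ring

theorem dividedBernoulli_sub_mem (h5 : 5 ≤ p) :
    dividedBernoulli (p + 1) - dividedBernoulli 2 ∈ M 1 := by
  have h2 : dividedBernoulli 2 ∈ M 0 :=
    dividedBernoulli_mem h5 (by omega) (Nat.not_dvd_of_pos_of_lt (by omega) (by omega))
  have h3 : dividedBernoulli (p + 1) ∈ M 0 := by
    rw [show p + 1 = 2 + 1 * (p - 1) by omega]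
    exact dividedBernoulli_mem h5 (by omega) (not_dvd_add_mul (by omega) (by omega) 1)
  refine sub_mem_of_red_eq h3 h2 ?_
  rw [show p + 1 = 2 + 1 * (p - 1) by omega]
  exact red_dividedBernoulli_add_mul h5 le_rfl (by omega) 1

/-- In the second difference over the exponents `2`, `p + 1`, `2p`, the terms `p B_m = p m β_m` give
`2(β_{2p} - β_{p+1}) - 2(β_{p+1} - β_2)/p`. Kummer kills the first part; the second needs the next
digit. The `-1/2` comes from `B_1` in `S_2`. -/
theorem sum_red_fermatQuotient_sq_mul_sq (h5 : 5 ≤ p) :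
    ∑ a ∈ Icc 1 (p - 1), red p (fermatQuotient p a) ^ 2 * (a : ZMod p) ^ 2 =
      -2 * red p ((dividedBernoulli (p + 1) - dividedBernoulli 2) / p) - 2⁻¹ := by
  have hp0 := cast_p_ne_zero (p := p)
  have hodd := odd_prime h5
  have s0 := powerSum_congr_three h5 (le_refl 2)
  have s1 := powerSum_congr_three h5 (show 2 ≤ p + 1 by omega)
  have s2 := powerSum_congr_three h5 (show 2 ≤ 2 * p by omega)
  have hD := dividedBernoulli_sub_mem h5
  have hD0 : (dividedBernoulli (p + 1) - dividedBernoulli 2) / p ∈ M 0 := by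
    simpa using div_p_pow_mem (k := 1) (n := 0) hD
  have hK : dividedBernoulli (2 * p) - dividedBernoulli (p + 1) ∈ M 1 := by
    have h2 := dividedBernoulli_mem h5 (by omega) (not_dvd_add_mul (p := p) (r := 2)
      (by omega) (by omega) 1)
    have h3 := dividedBernoulli_mem h5 (by omega) (not_dvd_add_mul (p := p) (r := 2)
      (by omega) (by omega) 2)
    have h := sub_mem_of_red_eq h3 h2 (by
      rw [red_dividedBernoulli_add_mul h5 le_rfl (by omega),
        red_dividedBernoulli_add_mul h5 le_rfl (by omega)])
    rwa [show 2 + 1 * (p - 1) = p + 1 by omega, show 2 + 2 * (p - 1) = 2 * p by omega] at h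
  have e0 : bernoulli 2 = 2 * dividedBernoulli 2 := by
    rw [dividedBernoulli]; push_cast; field_simp
  have e1 : bernoulli (p + 1) = (p + 1) * dividedBernoulli (p + 1) := by
    rw [dividedBernoulli]; push_cast; field_simp
  have e2 : bernoulli (2 * p) = 2 * p * dividedBernoulli (2 * p) := by
    rw [dividedBernoulli]; push_cast; field_simp
  have b1 : bernoulli (p + 1 - 1) = 0 := bernoulli_eq_zero_of_odd hodd (by omega)
  have b2 : bernoulli (2 * p - 1) = 0 := by
    rw [show 2 * p - 1 = 2 * (p - 1) + 1 by omega]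
    exact bernoulli_eq_zero_of_odd (odd_two_mul_add_one _) (by omega)
  rw [show 2 - 2 = 0 by rfl, show 2 - 1 = 1 by rfl, bernoulli_zero, bernoulli_one, e0,
    Nat.choose_self] at s0
  rw [show p + 1 - 2 = p - 1 by omega, b1, e1, Nat.cast_choose_two] at s1
  rw [b2, e2, Nat.cast_choose_two] at s2
  -- The cubic terms are negligible: `C(p+1,2)` and `C(2p,2)` carry the factor `p` that makes
  -- `B_{p-1}` and `B_{2p-2}` integral.
  have t0 := div_mem (not_dvd_three h5) (p_pow_mem (p := p) 3)
  have t1 := mul_mem_left (mul_mem_left (natCast_mem (p + 1)) (p_mul_bernoulli_mem h5 (p - 1)))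
    (div_mem (not_dvd_two h5) t0)
  have t2 := mul_mem_left (mul_mem_left (sub_mem (natCast_mem (2 * p)) one_mem)
    (p_mul_bernoulli_mem h5 (2 * p - 2))) t0
  have s1' := add_mem s1 t1
  have s2' := add_mem s2 t2
  have s0' := add_mem s0 t0
  have s := div_p_pow_mem (k := 2) (n := 1)
    (add_mem (sub_mem s2' (mul_mem_left (ofNat_mem 2) s1')) s0')
  have hm := add_mem s (mul_mem_left (ofNat_mem 2) hK)
  have hi := inv_mem (not_dvd_two h5)
  have hy := sub_mem (mul_mem_left (natCast_mem 2) (neg_mem hD0)) hi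
  rw [← red_sum_fermatQuotient, sum_fermatQuotient_sq_mul_pow]
  rw [red_eq_of_sub_mem hy, red_sub (mul_mem_left (natCast_mem 2) (neg_mem hD0)) hi,
    red_mul (natCast_mem 2) (neg_mem hD0), red_neg hD0, red_inv (not_dvd_two h5), red_natCast]
  · push_cast
    ring
  · convert hm using 1
    rw [show 2 + 2 * (p - 1) = 2 * p by omega, show 2 + 1 * (p - 1) = p + 1 by omega]
    push_cast
    field_simp
    ring

/-! ### The cubic moment -/

/-- The third difference of `j ↦ p B_{j(p-1)}` at `0`, with `p B_0` replaced by `p - 1`, divided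
by `2 p ^ 3`. -/
def bernoulliDifferenceQuotient (p : ℕ) : ℚ :=
  ((p : ℚ) * bernoulli (3 * (p - 1)) - 3 * (p : ℚ) * bernoulli (2 * (p - 1)) +
    3 * (p : ℚ) * bernoulli (p - 1) - (p : ℚ) + 1) / (2 * (p : ℚ) ^ 3)

theorem faulhaberTerm_three_mem (h5 : 5 ≤ p) (i : ℕ) :
    faulhaberTerm p ((i + 1) * (p - 1)) 3 ∈ M 4 := by
  have hb : bernoulli ((i + 1) * (p - 1) - 3) ∈ M 0 := by
    rw [show (i + 1) * (p - 1) - 3 = p - 4 + i * (p - 1) by rw [add_mul]; omega]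
    exact bernoulli_mem h5 (not_dvd_add_mul (by omega) (by omega) i)
  have h := mul_mem_left (mul_mem_left (natCast_mem (((i + 1) * (p - 1)).choose 3)) hb)
    (div_mem (not_dvd_two h5) (div_mem (not_dvd_two h5) (p_pow_mem (p := p) 4)))
  convert h using 1
  rw [faulhaberTerm]
  push_cast
  ring

theorem faulhaberTerm_four_mem (h5 : 5 ≤ p) {i : ℕ} (hi : i < 3) :
    faulhaberTerm p ((i + 1) * (p - 1)) 4 ∈ M 4 := by
  -- For `p = 5` the denominator of this term is `p` itself. It cancels against `C(8,4) = 5 · 14`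
  -- and `C(12,4) = 5 · 99`; for `i = 0` the Bernoulli number is `B_0 = 1`, so no factor `p` is
  -- spent on it.
  obtain rfl | hne := eq_or_ne p 5
  · rw [faulhaberTerm]
    interval_cases i
    · convert p_pow_mem (p := 5) 4 using 1
      norm_num
    · convert mul_mem_left (mul_mem_left (natCast_mem 14) (p_mul_bernoulli_mem h5 4))
        (p_pow_mem (p := 5) 4) using 1
      norm_num [Nat.choose]
      ring
    · convert mul_mem_left (mul_mem_left (natCast_mem 99) (p_mul_bernoulli_mem h5 8))
        (p_pow_mem (p := 5) 4) using 1
      norm_num [Nat.choose]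
      ring
  · have hd : ¬ p ∣ 5 := fun h => hne ((Nat.prime_dvd_prime_iff_eq hp.out Nat.prime_five).1 h)
    have h := mul_mem_left (mul_mem_left (natCast_mem (((i + 1) * (p - 1)).choose 4))
      (p_mul_bernoulli_mem h5 ((i + 1) * (p - 1) - 4))) (div_mem hd (p_pow_mem (p := p) 4))
    convert h using 1
    rw [faulhaberTerm]
    push_cast
    ring

/-- Six times the coefficient of `p ^ 3` in the expansion of `powerSum p m` in powers of `p`, for
`m = (i + 1) * (p - 1)`. -/
def secondCoeff (p i : ℕ) : ℚ :=
  (((i + 1) * (p - 1) : ℕ) : ℚ) * (((i + 1) * (p - 1) - 1 : ℕ) : ℚ) *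
    bernoulli (p - 3 + i * (p - 1))

theorem secondCoeff_mem (h5 : 5 ≤ p) (i : ℕ) : secondCoeff p i ∈ M 0 :=
  mul_mem_left (mul_mem_left (natCast_mem _) (natCast_mem _))
    (bernoulli_mem h5 (not_dvd_add_mul (by omega) (by omega) i))

theorem red_secondCoeff (h5 : 5 ≤ p) (i : ℕ) : red p (secondCoeff p i) =
    -((i + 1) * (i + 2) * (i + 3)) * red p (dividedBernoulli (p - 3)) := by
  rw [secondCoeff, red_mul (mul_mem_left (natCast_mem _) (natCast_mem _))
    (bernoulli_mem h5 (not_dvd_add_mul (by omega) (by omega) i)),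
    red_mul (natCast_mem _) (natCast_mem _), red_natCast, red_natCast,
    red_bernoulli_add_mul h5 (by omega) (by omega),
    Nat.cast_sub (Nat.mul_pos (Nat.succ_pos i) (by omega)), Nat.cast_sub (show 3 ≤ p by omega)]
  push_cast
  rw [natCast_sub_one, CharP.cast_eq_zero (ZMod p) p]
  ring

theorem powerSum_mul_sub_mem (h5 : 5 ≤ p) {i : ℕ} (hi : i < 3) :
    powerSum p ((i + 1) * (p - 1)) - ((p : ℚ) * bernoulli ((i + 1) * (p - 1)) +
      secondCoeff p i * (p : ℚ) ^ 3 / 6) ∈ M 4 := by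
  have h3 := faulhaberTerm_three_mem h5 i
  have h4 := faulhaberTerm_four_mem h5 hi
  have hev : Even ((i + 1) * (p - 1)) := (hp.out.even_sub_one (by omega)).mul_left _
  have hodd : Odd ((i + 1) * (p - 1) - 1) :=
    Nat.Even.sub_odd (Nat.mul_pos (Nat.succ_pos i) (by omega)) hev odd_one
  rw [secondCoeff, show p - 3 + i * (p - 1) = (i + 1) * (p - 1) - 2 by rw [add_mul]; omega]
  have hm : (i + 1) * (p - 1) = ((i + 1) * (p - 1) - 2) + 2 := by rw [add_mul]; omega
  set m := (i + 1) * (p - 1) with hm_def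
  have h1 : 1 < m - 1 := by
    have : p - 1 ≤ m := Nat.le_mul_of_pos_left _ (Nat.succ_pos i)
    omega
  have hc : ((m - 1 : ℕ) : ℚ) = (m : ℚ) - 1 := by
    rw [Nat.cast_sub (by omega), Nat.cast_one]
  have h := powerSum_sub_mem_four h5 (m - 2) (by rwa [← hm]) (by rwa [← hm])
  rw [← hm, show m - 2 + 1 = m - 1 by omega, bernoulli_eq_zero_of_odd hodd h1,
    Nat.cast_choose_two] at h
  convert h using 1
  rw [hc]
  ring

/-- The third difference of `S_{j(p-1)}` is needed modulo `p⁴`. The terms `p B` form twice the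
quotient; the terms in `p³` are `-j(j+1)(j+2) β_{p-3} / 6`, whose third difference is `-β_{p-3}`. -/
theorem sum_red_fermatQuotient_cube (h5 : 5 ≤ p) : bernoulliDifferenceQuotient p ∈ M 0 ∧
    ∑ a ∈ Icc 1 (p - 1), red p (fermatQuotient p a) ^ 3 =
      2 * red p (bernoulliDifferenceQuotient p) - red p (dividedBernoulli (p - 3)) := by
  have hp0 := cast_p_ne_zero (p := p)
  have s := div_p_pow_mem (k := 3) (n := 1) (add_mem (sub_mem
    (powerSum_mul_sub_mem h5 (show 2 < 3 by norm_num))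
    (mul_mem_left (natCast_mem 3) (powerSum_mul_sub_mem h5 (show 1 < 3 by norm_num))))
    (mul_mem_left (natCast_mem 3) (powerSum_mul_sub_mem h5 (show 0 < 3 by norm_num))))
  set V := secondCoeff p 2 - ((3 : ℕ) : ℚ) * secondCoeff p 1 + ((3 : ℕ) : ℚ) * secondCoeff p 0
    with hV
  have hV0 : V ∈ M 0 := add_mem (sub_mem (secondCoeff_mem h5 2)
    (mul_mem_left (natCast_mem 3) (secondCoeff_mem h5 1)))
    (mul_mem_left (natCast_mem 3) (secondCoeff_mem h5 0))
  have hVr : red p V = -6 * red p (dividedBernoulli (p - 3)) := by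
    rw [hV, red_add (sub_mem (secondCoeff_mem h5 2) (mul_mem_left (natCast_mem 3)
      (secondCoeff_mem h5 1))) (mul_mem_left (natCast_mem 3) (secondCoeff_mem h5 0)),
      red_sub (secondCoeff_mem h5 2) (mul_mem_left (natCast_mem 3) (secondCoeff_mem h5 1)),
      red_mul (natCast_mem 3) (secondCoeff_mem h5 1), red_mul (natCast_mem 3)
      (secondCoeff_mem h5 0), red_natCast, red_secondCoeff h5, red_secondCoeff h5,
      red_secondCoeff h5]
    push_cast
    ring
  have hq := sum_fermatQuotient_mem (p := p) 3 0
  have hr := red_sum_fermatQuotient (p := p) 3 0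
  simp only [pow_zero, mul_one] at hq hr
  have h2 := not_dvd_two h5
  have h3 := not_dvd_three h5
  have hiV : ((2 : ℕ) : ℚ)⁻¹ * (((3 : ℕ) : ℚ)⁻¹ * V) ∈ M 0 :=
    mul_mem_left (inv_mem h2) (mul_mem_left (inv_mem h3) hV0)
  have key : ∑ a ∈ Icc 1 (p - 1), fermatQuotient p a ^ 3 -
      (((2 : ℕ) : ℚ) * bernoulliDifferenceQuotient p + ((2 : ℕ) : ℚ)⁻¹ * (((3 : ℕ) : ℚ)⁻¹ * V))
        ∈ M 1 := by
    convert s using 1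
    rw [sum_fermatQuotient_cube, hV, bernoulliDifferenceQuotient]
    norm_num
    field_simp
    ring
  -- Integrality is read off the congruence itself, all its other terms being integral.
  have hG : bernoulliDifferenceQuotient p ∈ M 0 := by
    have h := mul_mem_left (inv_mem h2) (sub_mem (sub_mem hq (multiples_anti zero_le_one key)) hiV)
    convert h using 1
    push_cast
    ring
  refine ⟨hG, ?_⟩
  rw [← hr, red_eq_of_sub_mem (add_mem (mul_mem_left (natCast_mem 2) hG) hiV) key,
    red_add (mul_mem_left (natCast_mem 2) hG) hiV, red_mul (natCast_mem 2) hG,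
    red_mul (inv_mem h2) (mul_mem_left (inv_mem h3) hV0), red_mul (inv_mem h3) hV0, red_inv h2,
    red_inv h3, hVr, red_natCast]
  have h2' := two_ne_zero_zmod h5
  have h3' := three_ne_zero_zmod h5
  push_cast
  field_simp
  ring

/-! ### Fourier expansion of the Fermat quotient -/

theorem sum_pow_mul_inv_pow {a b : ℕ} (ha : a ∈ Icc 1 (p - 1)) (hb : b ∈ Icc 1 (p - 1)) :
    ∑ k ∈ range (p - 1), (b : ZMod p) ^ k * ((a : ZMod p) ^ k)⁻¹ = if b = a then -1 else 0 := by
  have ha0 := cast_ne_zero_of_mem_Icc ha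
  have hb0 := cast_ne_zero_of_mem_Icc hb
  have h : ∀ k, (b : ZMod p) ^ k * ((a : ZMod p) ^ k)⁻¹ = ((b : ZMod p) / a) ^ k := fun k => by
    rw [div_pow, div_eq_mul_inv]
  simp only [h]
  split_ifs with hab
  · rw [hab, div_self ha0]
    simp [natCast_sub_one]
  · have hx : (b : ZMod p) / a - 1 ≠ 0 := by
      rw [sub_ne_zero, Ne, div_eq_one_iff_eq ha0]
      rw [mem_Icc] at ha hb
      rw [ZMod.natCast_eq_natCast_iff]
      exact fun h => hab (h.eq_of_lt_of_lt (by omega) (by omega))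
    refine (mul_eq_zero.1 ?_).resolve_right hx
    rw [geom_sum_mul, ZMod.pow_card_sub_one_eq_one (div_ne_zero hb0 ha0), sub_self]

/-- Fourier inversion on `(ℤ/pℤ)ˣ`. -/
theorem eq_neg_sum_sum_mul_inv_pow (f : ℕ → ZMod p) {a : ℕ} (ha : a ∈ Icc 1 (p - 1)) :
    f a = -∑ k ∈ range (p - 1), (∑ b ∈ Icc 1 (p - 1), f b * (b : ZMod p) ^ k) *
      ((a : ZMod p) ^ k)⁻¹ := by
  simp only [sum_mul]
  rw [sum_comm]
  have h : ∀ b ∈ Icc 1 (p - 1), ∑ k ∈ range (p - 1), f b * (b : ZMod p) ^ k *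
      ((a : ZMod p) ^ k)⁻¹ = if b = a then -f b else 0 := fun b hb => by
    simp only [mul_assoc]
    rw [← mul_sum, sum_pow_mul_inv_pow ha hb]
    split_ifs <;> ring
  rw [sum_congr rfl h, sum_ite_eq' _ a, if_pos ha, neg_neg]

theorem dividedBernoulli_odd_eq_zero {m : ℕ} (h : Odd m) (h1 : 1 < m) :
    dividedBernoulli m = 0 := by
  rw [dividedBernoulli, bernoulli_eq_zero_of_odd h h1, zero_div]

/-- Fourier inversion with the first moments as coefficients; `k = 0` and `k = 1` are exceptional,
and `k = p - 2` drops out as an odd index. -/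
theorem red_fermatQuotient_eq (h5 : 5 ≤ p) {a : ℕ} (ha : a ∈ Icc 1 (p - 1)) :
    red p (fermatQuotient p a) = -red p (wilsonQuotient p) - 2⁻¹ * (a : ZMod p)⁻¹ +
      ∑ k ∈ Icc 2 (p - 3), red p (dividedBernoulli k) * ((a : ZMod p) ^ k)⁻¹ := by
  rw [eq_neg_sum_sum_mul_inv_pow (fun a => red p (fermatQuotient p a)) ha, range_eq_Ico,
    sum_eq_sum_Ico_succ_bot (by omega), sum_eq_sum_Ico_succ_bot (by omega)]
  simp only [pow_zero, mul_one, inv_one, zero_add, pow_one]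
  rw [sum_red_fermatQuotient h5, sum_red_fermatQuotient_mul_self h5]
  have h : ∑ k ∈ Ico 2 (p - 1), (∑ b ∈ Icc 1 (p - 1), red p (fermatQuotient p b) *
      (b : ZMod p) ^ k) * ((a : ZMod p) ^ k)⁻¹ =
      -∑ k ∈ Icc 2 (p - 3), red p (dividedBernoulli k) * ((a : ZMod p) ^ k)⁻¹ := by
    rw [← sum_neg_distrib, show p - 1 = (p - 2) + 1 by omega, sum_Ico_succ_top (by omega),
      show p - 2 + 1 = p - 1 by omega, sum_red_fermatQuotient_mul_pow h5 (by omega) (by omega),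
      dividedBernoulli_odd_eq_zero
        (show Odd (p - 2) from Nat.Odd.sub_even (by omega) (odd_prime h5) even_two) (by omega),
      red_zero, neg_zero, zero_mul, add_zero]
    refine sum_congr (by ext k; simp only [mem_Ico, mem_Icc]; omega) fun k hk => ?_
    rw [mem_Icc] at hk
    rw [sum_red_fermatQuotient_mul_pow h5 hk.1 (by omega), neg_mul]
  rw [h]
  ring

theorem inv_pow_eq {a k : ℕ} (ha : a ∈ Icc 1 (p - 1)) (hk : k ≤ p - 1) :
    ((a : ZMod p) ^ k)⁻¹ = (a : ZMod p) ^ (p - 1 - k) := by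
  have ha0 := cast_ne_zero_of_mem_Icc ha
  refine (eq_inv_of_mul_eq_one_right ?_).symm
  rw [← pow_add, Nat.add_sub_cancel' hk, ZMod.pow_card_sub_one_eq_one ha0]

theorem dividedBernoulli_mem_of_mem_Icc (h5 : 5 ≤ p) {k : ℕ} (hk : k ∈ Icc 2 (p - 3)) :
    dividedBernoulli k ∈ M 0 := by
  rw [mem_Icc] at hk
  exact dividedBernoulli_mem h5 (by omega) (Nat.not_dvd_of_pos_of_lt (by omega) (by omega))

theorem sub_mem_Icc {k : ℕ} (hk : k ∈ Icc 2 (p - 3)) : p - 1 - k ∈ Icc 2 (p - 3) := by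
  rw [mem_Icc] at hk ⊢
  omega

theorem dividedBernoulliConv_mem (h5 : 5 ≤ p) : dividedBernoulliConv (p - 1) ∈ M 0 := by
  refine sum_mem fun k hk => ?_
  rw [show p - 1 - 2 = p - 3 by omega] at hk
  exact mul_mem_left (dividedBernoulli_mem_of_mem_Icc h5 hk)
    (dividedBernoulli_mem_of_mem_Icc h5 (sub_mem_Icc hk))

theorem red_dividedBernoulliConv (h5 : 5 ≤ p) : red p (dividedBernoulliConv (p - 1)) =
    ∑ k ∈ Icc 2 (p - 3), red p (dividedBernoulli k) * red p (dividedBernoulli (p - 1 - k)) := by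
  rw [dividedBernoulliConv, show p - 1 - 2 = p - 3 by omega, red_sum _ fun k hk =>
    mul_mem_left (dividedBernoulli_mem_of_mem_Icc h5 hk)
    (dividedBernoulli_mem_of_mem_Icc h5 (sub_mem_Icc hk))]
  exact sum_congr rfl fun k hk => red_mul (dividedBernoulli_mem_of_mem_Icc h5 hk)
    (dividedBernoulli_mem_of_mem_Icc h5 (sub_mem_Icc hk))

/-- A Parseval argument: expand one factor of `q_a²` and sum against the other. The pairing `k ↔ p -
1 - k` produces the convolution, and the `a⁻¹` term meets the vanishing moment of index `p - 2`. -/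
theorem sum_red_fermatQuotient_sq (h5 : 5 ≤ p) :
    ∑ a ∈ Icc 1 (p - 1), red p (fermatQuotient p a) ^ 2 =
      -(red p (wilsonQuotient p) ^ 2 + red p (dividedBernoulliConv (p - 1))) := by
  have h : ∀ a ∈ Icc 1 (p - 1), red p (fermatQuotient p a) ^ 2 =
      -(red p (wilsonQuotient p) * red p (fermatQuotient p a)) -
      2⁻¹ * (red p (fermatQuotient p a) * (a : ZMod p) ^ (p - 2)) +
      ∑ k ∈ Icc 2 (p - 3), red p (dividedBernoulli k) *
        (red p (fermatQuotient p a) * (a : ZMod p) ^ (p - 1 - k)) := fun a ha => by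
    have e : ∑ k ∈ Icc 2 (p - 3), red p (dividedBernoulli k) *
        (red p (fermatQuotient p a) * (a : ZMod p) ^ (p - 1 - k)) = red p (fermatQuotient p a) *
        ∑ k ∈ Icc 2 (p - 3), red p (dividedBernoulli k) * ((a : ZMod p) ^ k)⁻¹ := by
      rw [mul_sum]
      refine sum_congr rfl fun k hk => ?_
      rw [mem_Icc] at hk
      rw [inv_pow_eq ha (by omega)]
      ring
    have e1 := inv_pow_eq ha (show 1 ≤ p - 1 by omega)
    rw [pow_one, show p - 1 - 1 = p - 2 by omega] at e1
    rw [e, ← e1]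
    linear_combination red p (fermatQuotient p a) * red_fermatQuotient_eq h5 ha
  rw [sum_congr rfl h, sum_add_distrib, sum_sub_distrib, sum_neg_distrib, ← mul_sum, ← mul_sum,
    sum_comm, sum_red_fermatQuotient h5, sum_red_fermatQuotient_mul_pow h5 (by omega) (by omega),
    dividedBernoulli_odd_eq_zero
      (show Odd (p - 2) from Nat.Odd.sub_even (by omega) (odd_prime h5) even_two) (by omega),
    red_dividedBernoulliConv h5]
  simp only [← mul_sum]
  have h' : ∑ k ∈ Icc 2 (p - 3), red p (dividedBernoulli k) * ∑ a ∈ Icc 1 (p - 1),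
      red p (fermatQuotient p a) * (a : ZMod p) ^ (p - 1 - k) =
      -∑ k ∈ Icc 2 (p - 3), red p (dividedBernoulli k) * red p (dividedBernoulli (p - 1 - k)) := by
    rw [← sum_neg_distrib]
    refine sum_congr rfl fun k hk => ?_
    have hk' := sub_mem_Icc hk
    rw [mem_Icc] at hk'
    rw [sum_red_fermatQuotient_mul_pow h5 hk'.1 (by omega), mul_neg]
  rw [h', red_zero]
  ring

theorem sum_dividedBernoulli_mul_inv_pow (h5 : 5 ≤ p) {a : ℕ} (ha : a ∈ Icc 1 (p - 1)) :
    ∑ k ∈ Icc 2 (p - 5), red p (dividedBernoulli k) * ((a : ZMod p) ^ k)⁻¹ =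
      red p (fermatQuotient p a) + red p (wilsonQuotient p) + 2⁻¹ * (a : ZMod p) ^ (p - 2) -
        red p (dividedBernoulli (p - 3)) * (a : ZMod p) ^ 2 := by
  have e : ∑ k ∈ Icc 2 (p - 3), red p (dividedBernoulli k) * ((a : ZMod p) ^ k)⁻¹ =
      red p (dividedBernoulli (p - 3)) * (a : ZMod p) ^ 2 +
      ∑ k ∈ Icc 2 (p - 5), red p (dividedBernoulli k) * ((a : ZMod p) ^ k)⁻¹ := by
    have hi := inv_pow_eq ha (show p - 3 ≤ p - 1 by omega)
    rw [show p - 1 - (p - 3) = 2 by omega] at hi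
    rw [← hi, ← sum_insert (s := Icc 2 (p - 5)) (a := p - 3) (f := fun k =>
      red p (dividedBernoulli k) * ((a : ZMod p) ^ k)⁻¹) (by rw [mem_Icc]; omega)]
    symm
    refine sum_subset (fun k hk => ?_) fun k hk hk' => ?_
    · rw [mem_insert, mem_Icc] at hk
      rw [mem_Icc]
      omega
    · rw [mem_insert, mem_Icc] at hk'
      rw [mem_Icc] at hk
      -- Apart from `p - 3`, the only index lost on shortening the range is the odd one `p - 4`.
      have hk4 : k = p - 4 := by omega
      rw [dividedBernoulli_odd_eq_zero (hk4 ▸ Nat.Odd.sub_even (by omega) (odd_prime h5)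
        (by decide)) (by omega), red_zero, zero_mul]
  have e1 := inv_pow_eq ha (show 1 ≤ p - 1 by omega)
  rw [pow_one, show p - 1 - 1 = p - 2 by omega] at e1
  have h := red_fermatQuotient_eq h5 ha
  rw [e, e1] at h
  linear_combination -h

/-! ### Hensel digits and the convolution -/

/-- Divisibility by `p^n` makes all lower digits vanish, so the truncation modulo `p^(n+1)` is `p^n`
times the digit. -/
theorem henselResidue_cast {x : ℚ} {n : ℕ} (hx : x ∈ M n) :
    (henselResidue p x n : ZMod p) = red p (x / (p : ℚ) ^ n) := by
  have hp0 := cast_p_ne_zero (p := p)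
  have hx0 : ‖(x : ℚ_[p])‖ ≤ 1 := mem_zero_iff.1 (multiples_anti (Nat.zero_le n) hx)
  obtain ⟨y, hy⟩ := hx
  rw [henselResidue, dif_pos hx0]
  set z : ℤ_[p] := ⟨(x : ℚ_[p]), hx0⟩ with hz
  change ((z.appr (n + 1) / p ^ n : ℕ) : ZMod p) = _
  have hzy : z = (p : ℤ_[p]) ^ n * y := Subtype.ext (by rw [hz]; push_cast; exact hy)
  have hxy : ((x / (p : ℚ) ^ n : ℚ) : ℚ_[p]) = y := by
    have h : (p : ℚ_[p]) ^ n ≠ 0 := pow_ne_zero _ (Nat.cast_ne_zero.2 hp.out.ne_zero)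
    push_cast
    rw [hy, mul_div_cancel_left₀ _ h]
  rw [red_eq_of_coe hxy]
  obtain ⟨w, hw⟩ := Ideal.mem_span_singleton.1 (PadicInt.appr_spec (n + 1) z)
  have hA : ((z.appr (n + 1) : ℕ) : ℤ_[p]) = (p : ℤ_[p]) ^ n * (y - p * w) := by
    linear_combination hzy - hw
  have hdvd : p ^ n ∣ z.appr (n + 1) := by
    have := (PadicInt.pow_p_dvd_int_iff n (z.appr (n + 1) : ℤ)).1
      ⟨y - (p : ℤ_[p]) * w, by rw [← hA]; simp⟩
    exact_mod_cast this
  obtain ⟨t, ht⟩ := hdvd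
  rw [ht, Nat.mul_div_cancel_left _ (pow_pos hp.out.pos n)]
  rw [ht] at hA
  push_cast at hA
  have h : (p : ℤ_[p]) ^ n ≠ 0 := pow_ne_zero _ (Nat.cast_ne_zero.2 hp.out.ne_zero)
  have hty := mul_left_cancel₀ h hA
  have := congrArg PadicInt.toZMod hty
  simpa using this

theorem red_sum_fermatQuotient_sq (h5 : 5 ≤ p) :
    red p (∑ a ∈ Icc 1 (p - 1), fermatQuotient p a ^ 2) =
      -(red p (wilsonQuotient p) ^ 2 + red p (dividedBernoulliConv (p - 1))) := by
  have h := red_sum_fermatQuotient (p := p) 2 0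
  simp only [pow_zero, mul_one] at h
  rw [h, sum_red_fermatQuotient_sq h5]

/-- Modulo `p ^ 3`, the difference of the squared and the doubled divided Bernoulli numbers is
`p ^ 2` times the convolution of order `p - 1`. -/
theorem two_mul_dividedBernoulli_sub_mem (h5 : 5 ≤ p) :
    2 * (p : ℚ) * dividedBernoulli (2 * (p - 1)) - (p : ℚ) ^ 2 * dividedBernoulli (p - 1) ^ 2 -
      (p : ℚ) ^ 2 * dividedBernoulliConv (p - 1) ∈ M 3 := by
  have hp0 := cast_p_ne_zero (p := p)
  have hP : ((p - 1 : ℕ) : ℚ) = (p : ℚ) - 1 := by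
    rw [Nat.cast_sub hp.out.one_le, Nat.cast_one]
  have hPd : ¬ p ∣ p - 1 := Nat.not_dvd_of_pos_of_lt (by omega) (by omega)
  have hP0 : ((p - 1 : ℕ) : ℚ) ≠ 0 := Nat.cast_ne_zero.2 (by omega)
  have hs : ∀ i < 3, powerSum p ((i + 1) * (p - 1)) - p * bernoulli ((i + 1) * (p - 1)) ∈ M 3 :=
    fun i hi => by
      have h := multiples_anti (show 3 ≤ 4 by norm_num) (powerSum_mul_sub_mem h5 hi)
      have t := mul_mem_left (secondCoeff_mem h5 i) (div_mem (not_dvd_two h5)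
        (div_mem (not_dvd_three h5) (p_pow_mem (p := p) 3)))
      convert add_mem h t using 1
      push_cast
      ring
  have s1 := hs 0 (by norm_num)
  have s2 := hs 1 (by norm_num)
  have b1 := p_mul_bernoulli_mem h5 (p - 1)
  rw [show (0 + 1) * (p - 1) = p - 1 by ring] at s1
  rw [show (1 + 1) * (p - 1) = 2 * (p - 1) by ring] at s2
  have s1' : powerSum p (p - 1) ∈ M 0 := by
    simpa using add_mem (multiples_anti (Nat.zero_le 3) s1) b1
  set v := ∑ a ∈ Icc 1 (p - 1), fermatQuotient p a with hv
  set u := ∑ a ∈ Icc 1 (p - 1), fermatQuotient p a ^ 2 with hu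
  have ev : v = (powerSum p (p - 1) - (p - 1)) / p := by
    have e := sum_fermatQuotient_mul_pow (p := p) 0
    simp only [pow_zero, mul_one, zero_add, one_mul, powerSum_zero] at e
    exact e
  have eu : u = (powerSum p (2 * (p - 1)) - 2 * powerSum p (p - 1) + (p - 1)) / (p : ℚ) ^ 2 := by
    have e := sum_fermatQuotient_sq_mul_pow (p := p) 0
    simp only [pow_zero, mul_one, zero_add, one_mul, powerSum_zero] at e
    exact e
  have hvm : v ∈ M 0 := by
    have h := sum_fermatQuotient_mem (p := p) 1 0
    simpa using h
  have hum : u ∈ M 0 := by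
    have h := sum_fermatQuotient_mem (p := p) 2 0
    simpa using h
  have hw := wilsonQuotient_mem (p := p)
  have hC := dividedBernoulliConv_mem h5
  have hPM := natCast_mem (p := p) (p - 1)
  -- With `P = p - 1`, `S_P = P + pv` and `S_{2P} = P + 2pv + p²u`, so `S_{2P}/P - (S_P/P)² = p²(uP
  -- - v²)/P²`. Modulo `p` the quotient is `-u - v²`, where `v ≡ w_p` and `u ≡ -(w_p² + C)` for the
  -- convolution `C`.
  have hmain : (u * ((p - 1 : ℕ) : ℚ) - v ^ 2) / ((p - 1 : ℕ) : ℚ) / ((p - 1 : ℕ) : ℚ) -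
      dividedBernoulliConv (p - 1) ∈ M 1 := by
    have h1 : u * ((p - 1 : ℕ) : ℚ) - v ^ 2 - (((p - 1 : ℕ) : ℚ) * (p - 1 : ℕ)) *
        dividedBernoulliConv (p - 1) ∈ M 1 := by
      refine sub_mem_of_red_eq (sub_mem (mul_mem_left hum hPM) (pow_mem hvm 2))
        (mul_mem_left (mul_mem_left hPM hPM) hC) ?_
      rw [red_sub (mul_mem_left hum hPM) (pow_mem hvm 2), red_mul hum hPM, red_pow hvm,
        red_mul (mul_mem_left hPM hPM) hC, red_mul hPM hPM, red_natCast, natCast_sub_one,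
        red_eq_of_sub_mem hw (sum_fermatQuotient_sub_wilsonQuotient_mem h5),
        red_sum_fermatQuotient_sq h5]
      ring
    convert div_mem hPd (div_mem hPd h1) using 1
    field_simp
  have h3 := mul_mem (p_pow_mem (p := p) 2) hmain
  have h4 := div_mem hPd s2
  have h5' := div_mem hPd (div_mem hPd (mul_mem_right s1 (add_mem s1' b1)))
  convert add_mem (sub_mem h3 h4) h5' using 1
  rw [eu, ev, dividedBernoulli, dividedBernoulli]
  rw [hP] at hP0 ⊢
  push_cast
  rw [hP]
  field_simp
  ring

/-! ### Assembling the moments -/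

/-- The stray multiples of `β_{p-3}` cancel: `-1` from `∑ q³`, `1/2` from `∑ q² a⁻¹`, and `1/2` from
the constant in `∑ q² a²`. -/
theorem red_doubleSum (h5 : 5 ≤ p) :
    (-(1 / 2 : ℚ) * ∑ a ∈ Icc 1 (p - 1), ∑ k ∈ Icc 2 (p - 5),
        dividedBernoulli k / (a : ℚ) ^ k * fermatQuotient p a ^ 2) ∈ M 0 ∧
    red p (-(1 / 2 : ℚ) * ∑ a ∈ Icc 1 (p - 1), ∑ k ∈ Icc 2 (p - 5),
        dividedBernoulli k / (a : ℚ) ^ k * fermatQuotient p a ^ 2) =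
      -red p ((dividedBernoulli (p + 1) - dividedBernoulli 2) / p) *
        red p (dividedBernoulli (p - 3)) + red p (wilsonQuotient p) * 2⁻¹ *
        (red p (wilsonQuotient p) ^ 2 + red p (dividedBernoulliConv (p - 1))) -
        red p (bernoulliDifferenceQuotient p) := by
  have hb : ∀ k ∈ Icc 2 (p - 5), dividedBernoulli k ∈ M 0 := fun k hk =>
    dividedBernoulli_mem_of_mem_Icc h5 (by rw [mem_Icc] at hk ⊢; omega)
  have hd : ∀ a ∈ Icc 1 (p - 1), ∀ k, ¬ p ∣ a ^ k := fun a ha k h =>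
    not_dvd_of_mem_Icc ha (hp.out.dvd_of_dvd_pow h)
  have hterm : ∀ a ∈ Icc 1 (p - 1), ∀ k ∈ Icc 2 (p - 5),
      dividedBernoulli k / (a : ℚ) ^ k ∈ M 0 ∧ red p (dividedBernoulli k / (a : ℚ) ^ k) =
        red p (dividedBernoulli k) * ((a : ZMod p) ^ k)⁻¹ := fun a ha k hk => by
    have e : dividedBernoulli k / (a : ℚ) ^ k = dividedBernoulli k * ((a ^ k : ℕ) : ℚ)⁻¹ := by
      rw [Nat.cast_pow, div_eq_mul_inv]
    rw [e]
    refine ⟨mul_mem_left (hb k hk) (inv_mem (hd a ha k)), ?_⟩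
    rw [red_mul (hb k hk) (inv_mem (hd a ha k)), red_inv (hd a ha k), Nat.cast_pow]
  have hq : ∀ a ∈ Icc 1 (p - 1), fermatQuotient p a ^ 2 ∈ M 0 := fun a ha =>
    pow_mem (fermatQuotient_mem (not_dvd_of_mem_Icc ha)) 2
  have hin : ∀ a ∈ Icc 1 (p - 1), ∀ k ∈ Icc 2 (p - 5),
      dividedBernoulli k / (a : ℚ) ^ k * fermatQuotient p a ^ 2 ∈ M 0 := fun a ha k hk =>
    mul_mem_left (hterm a ha k hk).1 (hq a ha)
  have hsum : ∑ a ∈ Icc 1 (p - 1), ∑ k ∈ Icc 2 (p - 5),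
      dividedBernoulli k / (a : ℚ) ^ k * fermatQuotient p a ^ 2 ∈ M 0 :=
    sum_mem fun a ha => sum_mem (hin a ha)
  have hhalf : -(1 / 2 : ℚ) = -((2 : ℕ) : ℚ)⁻¹ := by norm_num
  have hi := inv_mem (not_dvd_two h5)
  rw [hhalf]
  refine ⟨mul_mem_left (neg_mem hi) hsum, ?_⟩
  rw [red_mul (neg_mem hi) hsum, red_neg hi, red_inv (not_dvd_two h5),
    red_sum _ fun a ha => sum_mem (hin a ha)]
  have hrow : ∀ a ∈ Icc 1 (p - 1), red p (∑ k ∈ Icc 2 (p - 5),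
      dividedBernoulli k / (a : ℚ) ^ k * fermatQuotient p a ^ 2) =
      red p (fermatQuotient p a) ^ 3 + red p (wilsonQuotient p) * red p (fermatQuotient p a) ^ 2 +
      2⁻¹ * (red p (fermatQuotient p a) ^ 2 * (a : ZMod p) ^ (p - 2)) -
      red p (dividedBernoulli (p - 3)) * (red p (fermatQuotient p a) ^ 2 * (a : ZMod p) ^ 2) :=
    fun a ha => by
      rw [← sum_mul, red_mul (sum_mem fun k hk => (hterm a ha k hk).1) (hq a ha),
        red_sum _ fun k hk => (hterm a ha k hk).1, sum_congr rfl fun k hk => (hterm a ha k hk).2,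
        sum_dividedBernoulli_mul_inv_pow h5 ha, red_pow (fermatQuotient_mem (not_dvd_of_mem_Icc ha))]
      ring
  rw [sum_congr rfl hrow, sum_sub_distrib, sum_add_distrib, sum_add_distrib, ← mul_sum, ← mul_sum,
    ← mul_sum, (sum_red_fermatQuotient_cube h5).2, sum_red_fermatQuotient_sq h5,
    sum_red_fermatQuotient_sq_mul_pow_sub_two h5, sum_red_fermatQuotient_sq_mul_sq h5]
  have h2 := two_ne_zero_zmod h5
  push_cast
  field_simp
  ring

end PadicBernoulli

open PadicBernoulli in
theorem corollary5 (p : ℕ) [Fact p.Prime] (hp : 5 ≤ p) :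
    -- the quantities that occur are `p`-adic integers
    (IsPadicIntegral p (dividedBernoulli (p + 1) - dividedBernoulli 2) ∧
      IsPadicIntegral p (dividedBernoulli (p - 3)) ∧
      IsPadicIntegral p (wilsonQuotient p) ∧
      IsPadicIntegral p (dividedBernoulliConv (p - 1)) ∧
      IsPadicIntegral p
        (2 * (p : ℚ) * dividedBernoulli (2 * (p - 1)) -
          (p : ℚ) ^ 2 * dividedBernoulli (p - 1) ^ 2) ∧
      IsPadicIntegral p
        (((p : ℚ) * bernoulli (3 * (p - 1)) - 3 * (p : ℚ) * bernoulli (2 * (p - 1)) +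
          3 * (p : ℚ) * bernoulli (p - 1) - (p : ℚ) + 1) / (2 * (p : ℚ) ^ 3))) ∧
    -- the residue of the double sum
    PadicModEq p
      (-(1 / 2 : ℚ) * ∑ a ∈ Finset.Icc 1 (p - 1), ∑ k ∈ Finset.Icc 2 (p - 5),
        dividedBernoulli k / (a : ℚ) ^ k * fermatQuotient p a ^ 2)
      (-(henselResidue p (dividedBernoulli (p + 1) - dividedBernoulli 2) 1 : ℚ) *
          dividedBernoulli (p - 3) +
        wilsonQuotient p / 2 * (wilsonQuotient p ^ 2 + dividedBernoulliConv (p - 1)) -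
        ((p : ℚ) * bernoulli (3 * (p - 1)) - 3 * (p : ℚ) * bernoulli (2 * (p - 1)) +
          3 * (p : ℚ) * bernoulli (p - 1) - (p : ℚ) + 1) / (2 * (p : ℚ) ^ 3)) ∧
    -- the residues of the Wilson quotient and of the convolution of order `p - 1`
    PadicModEq p (wilsonQuotient p) (agohGiugaQuotient p - 1) ∧
    PadicModEq p (dividedBernoulliConv (p - 1))
      (henselResidue p
        (2 * (p : ℚ) * dividedBernoulli (2 * (p - 1)) -
          (p : ℚ) ^ 2 * dividedBernoulli (p - 1) ^ 2) 2 : ℚ) := by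
  have hD := dividedBernoulli_sub_mem hp
  have hb : dividedBernoulli (p - 3) ∈ padicMultiples p 0 :=
    dividedBernoulli_mem_of_mem_Icc hp (Finset.mem_Icc.2 ⟨by omega, le_rfl⟩)
  have hw := wilsonQuotient_mem (p := p)
  have hC := dividedBernoulliConv_mem hp
  have hG := (sum_red_fermatQuotient_cube hp).1
  have hX3 := two_mul_dividedBernoulli_sub_mem hp
  have hX : 2 * (p : ℚ) * dividedBernoulli (2 * (p - 1)) -
      (p : ℚ) ^ 2 * dividedBernoulli (p - 1) ^ 2 ∈ padicMultiples p 2 := by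
    have h := add_mem (multiples_anti (show 2 ≤ 3 by norm_num) hX3)
      (mul_mem_right (p_pow_mem (p := p) 2) hC)
    rwa [sub_add_cancel] at h
  have hL := red_doubleSum hp
  refine ⟨⟨mem_zero_iff.1 (multiples_anti zero_le_one hD), mem_zero_iff.1 hb, mem_zero_iff.1 hw,
    mem_zero_iff.1 hC, mem_zero_iff.1 (multiples_anti (Nat.zero_le 2) hX), mem_zero_iff.1 hG⟩,
    ?_, wilsonQuotient_modEq hp, ?_⟩
  · rw [← bernoulliDifferenceQuotient]
    have hi := inv_mem (not_dvd_two hp)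
    have hn := natCast_mem (p := p)
      (henselResidue p (dividedBernoulli (p + 1) - dividedBernoulli 2) 1)
    have h2 : wilsonQuotient p / 2 = wilsonQuotient p * ((2 : ℕ) : ℚ)⁻¹ := by
      rw [div_eq_mul_inv, Nat.cast_two]
    rw [h2]
    have m1 := mul_mem_left (neg_mem hn) hb
    have m2 := mul_mem_left hw hi
    have m3 := add_mem (pow_mem hw 2) hC
    have m4 := mul_mem_left m2 m3
    refine padicModEq_of_red_eq hL.1 (sub_mem (add_mem m1 m4) hG) ?_
    rw [hL.2, red_sub (add_mem m1 m4) hG, red_add m1 m4, red_mul (neg_mem hn) hb, red_neg hn,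
      red_natCast, henselResidue_cast hD, pow_one, red_mul m2 m3, red_mul hw hi,
      red_inv (not_dvd_two hp), red_add (pow_mem hw 2) hC, red_pow hw, Nat.cast_two]
  · refine padicModEq_of_red_eq hC (natCast_mem _) ?_
    -- Since the number lies in `p² ℤ_p`, its digit of index 2 is the residue of its quotient by
    -- `p²`.
    rw [red_natCast, henselResidue_cast hX]
    refine (red_eq_of_sub_mem hC ?_).symm
    convert div_p_pow_mem (k := 2) (n := 1) hX3 using 1
    have hp0 := cast_p_ne_zero (p := p)
    field_simp
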